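/- **Coherence of terms and processes (weakening of the functional context).** Consider Polarized SILL, the language that combines a simply typed functional layer with binary session-typed processes. *Types.* Session types $A$ have a polarity $p\in\{-,+\}$; positive ones are $\mathbf 1$, ${\downarrow}A^-$, $\oplus\{l:A_l\}_{l\in L}$, $A\otimes B$, $\tau\wedge A$, and negative ones are ${\uparrow}A^+$, $\&\{l:A_l\}_{l\in L}$, $A^+\multimap B^-$, $\tau\supset A$ ($L$ finite), where $\tau$ is a functional type; both polarities have variables $\alpha$ and recursive types $\rho\alpha.A$. Functional types are $\tau\to\sigma$ and the types $\{a:A\leftarrow\overline{a_i:A_i}\}$ of quoted processes. *Judgments.* $\Psi\vdash M:\tau$ (terms: variables, $\mathsf{fix}\,x.M$, $\lambda x:\tau.M$, application, quoted processes) and $\Psi;\Delta\vdash P::a:A$ (in the functional context $\Psi$, the process $P$ provides the session $A$ on channel $a$ and uses the channels of the linear context $\Delta$; the processes are forwarding, cut, the left and right rules of every session type, and running a quoted process), generated by the usual rules. *Semantics.* Domains are partial orders with a least element and directed suprema, morphisms are Scott-continuous maps. A session type denotes two domains $[\![A]\!]^-$, $[\![A]\!]^+$ (two functors of the domains of its type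 variables, when it has any), given by $[\![\mathbf 1]\!]^-=\{\bot\}$, $[\![\mathbf 1]\!]^+=\{*\}_\bot$; $[\![{\downarrow}A]\!]^-=[\![A]\!]^-$, $[\![{\downarrow}A]\!]^+=[\![A]\!]^+_\bot$; $[\![\oplus\{l:A_l\}]\!]^-=\prod_l[\![A_l]\!]^-$, $[\![\oplus\{l:A_l\}]\!]^+=\bigoplus_l([\![A_l]\!]^+)_\bot$ (coalesced sum); $[\![A\otimes B]\!]^-=[\![A]\!]^-\times[\![B]\!]^-$, $[\![A\otimes B]\!]^+=([\![A]\!]^+\times[\![B]\!]^+)_\bot$; $[\![A\multimap B]\!]^-=([\![A]\!]^+\times[\![B]\!]^-)_\bot$, $[\![A\multimap B]\!]^+=[\![A]\!]^-\times[\![B]\!]^+$; $[\![\tau\wedge A]\!]^-=[\![A]\!]^-$, $[\![\tau\wedge A]\!]^+=([\![\tau]\!]\times[\![A]\!]^+)_\bot$; dually, with the two aspects exchanged, for $\uparrow$ (as for $\downarrow$), $\&$ (as for $\oplus$) and $\supset$ (as for $\wedge$). A type variable denotes a pair of domains, and $[\![\rho\alpha.A]\!]$ is the canonical solution (the limit of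 the chain of projections starting at the one-point domain) of the domain equations for both aspects together. Further $[\![\tau\to\sigma]\!]$ is the domain of strict continuous maps, $[\![\{a:A\leftarrow\overline{a_i:A_i}\}]\!]=[\,\prod_i[\![A_i]\!]^+\times[\![A]\!]^-\to\prod_i[\![A_i]\!]^-\times[\![A]\!]^+\,]_\bot$, and contexts denote indexed products. By recursion on derivations, $\Psi\vdash M:\tau$ denotes a continuous map $[\![\Psi]\!]\to[\![\tau]\!]$, and $\Psi;\Delta\vdash P::a:A$ denotes a continuous map $$[\![\Psi]\!]\to\bigl[\,[\![\Delta]\!]^+\times[\![A]\!]^-\to[\![\Delta]\!]^-\times[\![A]\!]^+\,\bigr].$$ Here recursive terms are least fixed points with parameters, abstraction is made strict, quoting and running processes are the maps up and down of lifting, forwarding exchanges its two arguments, cut is the trace operator of the category at the channel that is cut, receiving is strict in the received communication (while sending lifts the communication that is sent, and a value is sent only if it is not $\bot$), and the rules for $\rho\alpha.A$ pre- and postcompose with the isomorphisms $\mathsf{Unfold}$ and $\mathsf{Fold}$. *Statement.* Let $\Phi$ and $\Psi$ be functional contexts and let $\pi^{\Phi,\Psi}_\Psi:[\![\Phi,\Psi]\!]\to[\![\Psi]\!]$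 be the projection. A derivation in the context $\Psi$ becomes, by the same rules with the same subjects, a derivation in the context $\Phi,\Psi$, and for these derivations: 1. if $\Psi\vdash M:\tau$, then $[\![\Phi,\Psi\vdash M:\tau]\!]=[\![\Psi\vdash M:\tau]\!]\circ\pi^{\Phi,\Psi}_\Psi$; 2. if $\Psi;\Delta\vdash P::a:A$, then $[\![\Phi,\Psi;\Delta\vdash P::a:A]\!]=[\![\Psi;\Delta\vdash P::a:A]\!]\circ\pi^{\Phi,\Psi}_\Psi$. -/

import Mathlib

namespace SILL

noncomputable section

/-! ### Pointed directed-complete partial orders -/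

/-- Every nonempty directed set has a least upper bound. -/
class DirComplete (α : Type) [PartialOrder α] : Prop where
  exists_lub : ∀ s : Set α, s.Nonempty → DirectedOn (· ≤ ·) s → ∃ x, IsLUB s x

/-- A domain: a partial order with a least element and suprema of directed sets. -/
structure Dom : Type 1 where
  carrier : Type
  [order : PartialOrder carrier]
  [bot : OrderBot carrier]
  [dcpo : DirComplete carrier]

instance : CoeSort Dom Type := ⟨Dom.carrier⟩

attribute [instance] Dom.order Dom.bot Dom.dcpo

theorem directedOn_image_of_monotone {α β : Type} [PartialOrder α] [PartialOrder β] {f : α → β}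
    (hf : Monotone f) {s : Set α} (hs : DirectedOn (· ≤ ·) s) :
    DirectedOn (· ≤ ·) (f '' s) := by
  rintro _ ⟨x, hx, rfl⟩ _ ⟨y, hy, rfl⟩
  obtain ⟨z, hz, h1, h2⟩ := hs x hx y hy
  exact ⟨f z, ⟨z, hz, rfl⟩, hf h1, hf h2⟩

/-- Scott-continuous functions. -/
structure CFun (α β : Type) [PartialOrder α] [PartialOrder β] where
  toFun : α → β
  cont : ScottContinuous toFun

instance {α β : Type} [PartialOrder α] [PartialOrder β] : FunLike (CFun α β) α β where
  coe := CFun.toFun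
  coe_injective f g h := by cases f; cases g; cases h; rfl

namespace CFun

variable {α β γ δ : Type} [PartialOrder α] [PartialOrder β] [PartialOrder γ] [PartialOrder δ]

theorem ext {f g : CFun α β} (h : ∀ x, f x = g x) : f = g := DFunLike.ext f g h

theorem mono (f : CFun α β) : Monotone f := f.cont.monotone

instance : PartialOrder (CFun α β) := PartialOrder.lift (fun f => (f : α → β)) DFunLike.coe_injective

instance [OrderBot β] : OrderBot (CFun α β) where
  bot := ⟨fun _ => ⊥, ScottContinuous.const ⊥⟩
  bot_le f := fun x => (bot_le : ⊥ ≤ f x)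

theorem exists_pointwise_lub [DirComplete β] (S : Set (CFun α β)) (hS : S.Nonempty)
    (hd : DirectedOn (· ≤ ·) S) :
    ∃ g : CFun α β, ∀ x, IsLUB ((fun f : CFun α β => f x) '' S) (g x) := by
  have h : ∀ x, ∃ y, IsLUB ((fun f : CFun α β => f x) '' S) y := fun x =>
    DirComplete.exists_lub _ (hS.image _)
      (directedOn_image_of_monotone (f := fun f : CFun α β => f x)
        (fun f g (h : f ≤ g) => h x) hd)
  choose g hg using h
  refine ⟨⟨g, ?_⟩, hg⟩
  intro s _ _ a ha
  refine ⟨?_, ?_⟩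
  · rintro _ ⟨x, hx, rfl⟩
    refine (hg x).2 ?_
    rintro _ ⟨f, hf, rfl⟩
    exact (f.mono (ha.1 hx)).trans ((hg a).1 ⟨f, hf, rfl⟩)
  · intro b hb
    refine (hg a).2 ?_
    rintro _ ⟨f, hf, rfl⟩
    refine (f.cont ‹_› ‹_› ha).2 ?_
    rintro _ ⟨x, hx, rfl⟩
    exact ((hg x).1 ⟨f, hf, rfl⟩).trans (hb ⟨x, hx, rfl⟩)

theorem isLUB_of_pointwise {S : Set (CFun α β)} {g : CFun α β}
    (h : ∀ x, IsLUB ((fun f : CFun α β => f x) '' S) (g x)) : IsLUB S g :=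
  ⟨fun f hf x => (h x).1 ⟨f, hf, rfl⟩, fun k hk x => (h x).2 (by
    rintro _ ⟨f, hf, rfl⟩
    exact hk hf x)⟩

theorem pointwise_of_isLUB [DirComplete β] {S : Set (CFun α β)} {g : CFun α β} (hS : S.Nonempty)
    (hd : DirectedOn (· ≤ ·) S) (h : IsLUB S g) (x : α) :
    IsLUB ((fun f : CFun α β => f x) '' S) (g x) := by
  obtain ⟨k, hk⟩ := exists_pointwise_lub S hS hd
  rw [h.unique (isLUB_of_pointwise hk)]
  exact hk x

instance [DirComplete β] : DirComplete (CFun α β) where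
  exists_lub S hS hd :=
    let ⟨g, hg⟩ := exists_pointwise_lub S hS hd
    ⟨g, isLUB_of_pointwise hg⟩

@[fun_prop]
theorem scott_coe (f : CFun α β) : ScottContinuous (f : α → β) := f.cont

/-- Application is jointly continuous. -/
theorem scott_eval [DirComplete β] : ScottContinuous (fun p : CFun α β × α => p.1 p.2) :=
  ScottContinuous.fromProd (fun f => f.cont) (fun x _ hS hd _ h => pointwise_of_isLUB hS hd h x)

@[fun_prop]
theorem scott_apply [DirComplete γ] {f : α → CFun β γ} {g : α → β} (hf : ScottContinuous f)
    (hg : ScottContinuous g) : ScottContinuous (fun x => f x (g x)) :=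
  ScottContinuous.comp (f := fun x => (f x, g x)) (hf.prodMk hg) scott_eval

/-- Composition of continuous functions. -/
def comp (g : CFun β γ) (f : CFun α β) : CFun α γ := ⟨fun x => g (f x), by fun_prop⟩

/-- Currying. -/
def curry [DirComplete γ] (f : CFun (α × β) γ) : CFun α (CFun β γ) where
  toFun a := ⟨fun b => f (a, b), by fun_prop⟩
  cont s hs hd a ha := isLUB_of_pointwise fun b => by
    rw [Set.image_image]
    exact (show ScottContinuous fun a => f (a, b) by fun_prop) hs hd ha

end CFun

/-- Strict Scott-continuous functions. -/
structure SFun (α β : Type) [PartialOrder α] [PartialOrder β] [OrderBot α] [OrderBot β]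
    extends CFun α β where
  strict : toFun ⊥ = ⊥

namespace SFun

variable {α β γ : Type} [PartialOrder α] [PartialOrder β] [PartialOrder γ]
  [OrderBot α] [OrderBot β] [OrderBot γ]

theorem toCFun_injective : Function.Injective (toCFun : SFun α β → CFun α β) := by
  rintro ⟨f, _⟩ ⟨g, _⟩ h
  cases h
  rfl

instance : FunLike (SFun α β) α β where
  coe f := f.toCFun
  coe_injective _ _ h := toCFun_injective (DFunLike.coe_injective h)

theorem ext {f g : SFun α β} (h : ∀ x, f x = g x) : f = g := DFunLike.ext f g h

instance : PartialOrder (SFun α β) := PartialOrder.lift toCFun toCFun_injective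

instance : OrderBot (SFun α β) where
  bot := ⟨⊥, rfl⟩
  bot_le _ _ := bot_le

@[fun_prop]
theorem scott_coe (f : SFun α β) : ScottContinuous (f : α → β) := f.cont

theorem exists_pointwise_lub [DirComplete β] (S : Set (SFun α β)) (hS : S.Nonempty)
    (hd : DirectedOn (· ≤ ·) S) :
    ∃ g : SFun α β, IsLUB S g ∧ IsLUB (toCFun '' S) g.toCFun := by
  obtain ⟨g, hg⟩ := CFun.exists_pointwise_lub (toCFun '' S) (hS.image _)
    (directedOn_image_of_monotone (f := (toCFun : SFun α β → CFun α β)) (fun _ _ h => h) hd)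
  have hl := CFun.isLUB_of_pointwise hg
  refine ⟨⟨g, ?_⟩, ⟨fun f hf => hl.1 ⟨f, hf, rfl⟩, fun k hk => hl.2 ?_⟩, hl⟩
  · refine le_bot_iff.mp ((hg ⊥).2 ?_)
    rintro _ ⟨_, ⟨f, _, rfl⟩, rfl⟩
    exact f.strict.le
  · rintro _ ⟨f, hf, rfl⟩
    exact hk hf

instance [DirComplete β] : DirComplete (SFun α β) where
  exists_lub S hS hd :=
    let ⟨g, hg, _⟩ := exists_pointwise_lub S hS hd
    ⟨g, hg⟩

@[fun_prop]
theorem scott_toCFun [DirComplete β] : ScottContinuous (toCFun : SFun α β → CFun α β) := by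
  intro S hS hd a ha
  obtain ⟨g, hg, hg'⟩ := exists_pointwise_lub S hS hd
  rw [ha.unique hg]
  exact hg'

@[fun_prop]
theorem scott_apply {δ : Type} [PartialOrder δ] [DirComplete β] {f : δ → SFun α β} {g : δ → α}
    (hf : ScottContinuous f) (hg : ScottContinuous g) : ScottContinuous (fun x => f x (g x)) :=
  show ScottContinuous (fun x => (f x).toCFun (g x)) by fun_prop

/-- The identity. -/
def id : SFun α α := ⟨⟨fun x => x, by fun_prop⟩, rfl⟩

/-- Composition of strict functions. -/
def comp (g : SFun β γ) (f : SFun α β) : SFun α γ :=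
  ⟨g.toCFun.comp f.toCFun, (congrArg g f.strict).trans g.strict⟩

end SFun

instance {α β : Type} [PartialOrder α] [PartialOrder β] [DirComplete α] [DirComplete β] :
    DirComplete (α × β) where
  exists_lub s hs hd := by
    obtain ⟨a, ha⟩ := DirComplete.exists_lub _ (hs.image Prod.fst)
      (directedOn_image_of_monotone monotone_fst hd)
    obtain ⟨b, hb⟩ := DirComplete.exists_lub _ (hs.image Prod.snd)
      (directedOn_image_of_monotone monotone_snd hd)
    exact ⟨(a, b), isLUB_prod.mpr ⟨ha, hb⟩⟩

instance {I : Type} {D : I → Type} [∀ i, PartialOrder (D i)] [∀ i, DirComplete (D i)] :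
    DirComplete (∀ i, D i) where
  exists_lub s hs hd := by
    have h : ∀ i, ∃ y, IsLUB (Function.eval i '' s) y := fun i => DirComplete.exists_lub _
      (hs.image _) (directedOn_image_of_monotone (Function.monotone_eval i) hd)
    choose g hg using h
    exact ⟨g, isLUB_pi.mpr hg⟩

instance : DirComplete PUnit where
  exists_lub _ _ _ := ⟨⟨⟩, fun _ _ => le_rfl, fun _ _ => le_rfl⟩

theorem scott_congr {α β : Type} [PartialOrder α] [PartialOrder β] {f g : α → β}
    (hf : ScottContinuous f) (h : ∀ x, f x = g x) : ScottContinuous g :=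
  (funext h : f = g) ▸ hf

theorem scott_pi {α I : Type} {D : I → Type} [PartialOrder α] [∀ i, PartialOrder (D i)]
    {f : α → ∀ i, D i} (h : ∀ i, ScottContinuous (fun x => f x i)) : ScottContinuous f := by
  intro s hs hd a ha
  refine isLUB_pi.mpr fun i => ?_
  rw [Set.image_image]
  exact h i hs hd ha

@[fun_prop]
theorem scott_eval_pi {I : Type} {D : I → Type} [∀ i, PartialOrder (D i)] (i : I) :
    ScottContinuous (fun f : ∀ i, D i => f i) :=
  fun _ _ _ _ ha => isLUB_pi.mp ha i

/-! Lifting: `WithBot α` is `α` with a new least element. -/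

theorem isLUB_withBot_coe {α : Type} [PartialOrder α] {s : Set α} (hs : s.Nonempty) {a : α}
    (ha : IsLUB s a) : IsLUB ((fun x : α => (x : WithBot α)) '' s) (a : WithBot α) := by
  refine ⟨?_, ?_⟩
  · rintro _ ⟨x, hx, rfl⟩
    exact WithBot.coe_le_coe.mpr (ha.1 hx)
  · intro b hb
    obtain ⟨x, hx⟩ := hs
    induction b using WithBot.recBotCoe with
    | bot => exact absurd (hb ⟨x, hx, rfl⟩) (WithBot.not_coe_le_bot x)
    | coe b =>
      refine WithBot.coe_le_coe.mpr (ha.2 fun y hy => ?_)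
      exact WithBot.coe_le_coe.mp (hb ⟨y, hy, rfl⟩)

/-- A directed set in a lifting is `{⊥}` or, up to `⊥`, a directed set of lifted elements. -/
theorem withBot_directed {α : Type} [PartialOrder α] {s : Set (WithBot α)}
    (hd : DirectedOn (· ≤ ·) s) : DirectedOn (· ≤ ·) {x : α | (x : WithBot α) ∈ s} := by
  intro x hx y hy
  obtain ⟨z, hz, h1, h2⟩ := hd _ hx _ hy
  induction z using WithBot.recBotCoe with
  | bot => exact absurd h1 (WithBot.not_coe_le_bot x)
  | coe z => exact ⟨z, hz, WithBot.coe_le_coe.mp h1, WithBot.coe_le_coe.mp h2⟩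

theorem withBot_upperBounds {α : Type} [PartialOrder α] (s : Set (WithBot α)) :
    upperBounds ((fun x : α => (x : WithBot α)) '' {x : α | (x : WithBot α) ∈ s}) =
      upperBounds s := by
  ext b
  refine ⟨fun h x hx => ?_, ?_⟩
  · induction x using WithBot.recBotCoe with
    | bot => exact bot_le
    | coe x => exact h ⟨x, hx, rfl⟩
  · rintro h _ ⟨x, hx, rfl⟩
    exact h hx

instance {α : Type} [PartialOrder α] [DirComplete α] : DirComplete (WithBot α) where
  exists_lub s _ hd := by
    by_cases h : {x : α | (x : WithBot α) ∈ s}.Nonempty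
    · obtain ⟨a, ha⟩ := DirComplete.exists_lub _ h (withBot_directed hd)
      exact ⟨a, (isLUB_congr (withBot_upperBounds s)).mp (isLUB_withBot_coe h ha)⟩
    · refine ⟨⊥, fun x hx => ?_, fun b _ => bot_le⟩
      induction x using WithBot.recBotCoe with
      | bot => exact le_rfl
      | coe x => exact absurd ⟨x, hx⟩ h

/-- The strict extension of `f` to the lifting: `⊥ ↦ ⊥` and `↑x ↦ f x`. -/
def liftExt {α β : Type} [PartialOrder α] [PartialOrder β] [OrderBot β]
    (f : α → β) : WithBot α → β := WithBot.recBotCoe ⊥ f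

@[fun_prop]
theorem scott_up {α : Type} [PartialOrder α] : ScottContinuous (fun x : α => (x : WithBot α)) :=
  fun _ hs _ _ ha => isLUB_withBot_coe hs ha

theorem scott_liftExt {α β : Type} [PartialOrder α] [PartialOrder β] [OrderBot β]
    [DirComplete α] {f : α → β} (hf : ScottContinuous f) : ScottContinuous (liftExt f) := by
  intro s hs hd a ha
  have hm : Monotone (liftExt f) := by
    intro x y h
    induction x using WithBot.recBotCoe with
    | bot => exact bot_le
    | coe x =>
      induction y using WithBot.recBotCoe with
      | bot => exact absurd h (WithBot.not_coe_le_bot x)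
      | coe y => exact hf.monotone (WithBot.coe_le_coe.mp h)
  refine ⟨?_, fun b hb => ?_⟩
  · rintro _ ⟨x, hx, rfl⟩
    exact hm (ha.1 hx)
  · by_cases h : {x : α | (x : WithBot α) ∈ s}.Nonempty
    · obtain ⟨a', ha'⟩ := DirComplete.exists_lub _ h (withBot_directed hd)
      have := (isLUB_congr (withBot_upperBounds s)).mp (isLUB_withBot_coe h ha')
      rw [ha.unique this]
      refine (hf h (withBot_directed hd) ha').2 ?_
      rintro _ ⟨x, hx, rfl⟩
      exact hb ⟨(x : WithBot α), hx, rfl⟩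
    · have : a = ⊥ := by
        refine le_bot_iff.mp (ha.2 fun x hx => ?_)
        induction x using WithBot.recBotCoe with
        | bot => exact le_rfl
        | coe x => exact absurd ⟨x, hx⟩ h
      rw [this]
      exact bot_le

/-! Disjoint unions. -/

theorem isLUB_sigma {I : Type} {D : I → Type} [∀ i, PartialOrder (D i)] {i : I} {s : Set (D i)}
    (hs : s.Nonempty) {a : D i} (ha : IsLUB s a) :
    IsLUB (Sigma.mk i '' s) (⟨i, a⟩ : Σ i, D i) := by
  refine ⟨?_, ?_⟩
  · rintro _ ⟨x, hx, rfl⟩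
    exact Sigma.mk_le_mk_iff.mpr (ha.1 hx)
  · rintro ⟨j, b⟩ hb
    obtain ⟨x, hx⟩ := hs
    obtain ⟨h, _⟩ := Sigma.le_def.mp (hb ⟨x, hx, rfl⟩)
    cases h
    exact Sigma.mk_le_mk_iff.mpr (ha.2 fun y hy => Sigma.mk_le_mk_iff.mp (hb ⟨y, hy, rfl⟩))

theorem sigma_directed {I : Type} {D : I → Type} [∀ i, PartialOrder (D i)] {s : Set (Σ i, D i)}
    (hs : s.Nonempty) (hd : DirectedOn (· ≤ ·) s) :
    ∃ (i : I) (t : Set (D i)), t.Nonempty ∧ DirectedOn (· ≤ ·) t ∧ s = Sigma.mk i '' t := by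
  obtain ⟨⟨i, x⟩, hx⟩ := hs
  refine ⟨i, {y | (⟨i, y⟩ : Σ i, D i) ∈ s}, ⟨x, hx⟩, ?_, ?_⟩
  · intro y hy z hz
    obtain ⟨⟨j, w⟩, hw, h1, h2⟩ := hd _ hy _ hz
    obtain ⟨h, _⟩ := Sigma.le_def.mp h1
    cases h
    exact ⟨w, hw, Sigma.mk_le_mk_iff.mp h1, Sigma.mk_le_mk_iff.mp h2⟩
  · ext ⟨j, y⟩
    refine ⟨fun hy => ?_, ?_⟩
    · obtain ⟨⟨k, w⟩, hw, h1, h2⟩ := hd _ hx _ hy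
      obtain ⟨h, _⟩ := Sigma.le_def.mp h1
      obtain ⟨h', _⟩ := Sigma.le_def.mp h2
      cases h
      cases h'
      exact ⟨y, hy, rfl⟩
    · rintro ⟨z, hz, h⟩
      cases h
      exact hz

instance {I : Type} {D : I → Type} [∀ i, PartialOrder (D i)] [∀ i, DirComplete (D i)] :
    DirComplete (Σ i, D i) where
  exists_lub s hs hd := by
    obtain ⟨i, t, ht, htd, rfl⟩ := sigma_directed hs hd
    obtain ⟨a, ha⟩ := DirComplete.exists_lub t ht htd
    exact ⟨⟨i, a⟩, isLUB_sigma ht ha⟩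

theorem scott_sigma_mk {I : Type} {D : I → Type} [∀ i, PartialOrder (D i)] (i : I) :
    ScottContinuous (fun x : D i => (⟨i, x⟩ : Σ i, D i)) :=
  fun _ hs _ _ ha => isLUB_sigma hs ha

theorem scott_sigma {I β : Type} {D : I → Type} [∀ i, PartialOrder (D i)] [PartialOrder β]
    [∀ i, DirComplete (D i)]
    {f : (Σ i, D i) → β} (h : ∀ i, ScottContinuous (fun x : D i => f ⟨i, x⟩)) :
    ScottContinuous f := by
  intro s hs hd a ha
  obtain ⟨i, t, ht, htd, rfl⟩ := sigma_directed hs hd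
  obtain ⟨b, hb⟩ := DirComplete.exists_lub t ht htd
  rw [ha.unique (isLUB_sigma ht hb), Set.image_image]
  exact h i ht htd hb

/-! The constructions on domains. -/

namespace Dom

/-- The one-element domain. -/
abbrev unit : Dom := ⟨PUnit⟩
/-- Binary products. -/
abbrev prod (D E : Dom) : Dom := ⟨D × E⟩
/-- Indexed products. -/
abbrev pi {I : Type} (D : I → Dom) : Dom := ⟨∀ i, D i⟩
/-- Lifting of a directed-complete partial order. -/
abbrev lift (α : Type) [PartialOrder α] [DirComplete α] : Dom := ⟨WithBot α⟩
/-- The coalesced sum of the liftings `(D i)_⊥`, as the lifting of the disjoint union of the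
`D i`: its elements are `⊥` and the pairs `(i, d)` with `d ∈ D i`. -/
abbrev sum {I : Type} (D : I → Dom) : Dom := lift (Σ i, D i)
/-- The domain of continuous functions. -/
abbrev fn (D E : Dom) : Dom := ⟨CFun D E⟩
/-- The domain of strict continuous functions. -/
abbrev sfn (D E : Dom) : Dom := ⟨SFun D E⟩

end Dom

/-! ### The category of domains and strict functions, and its functors -/

open CategoryTheory

instance : Category.{0} Dom where
  Hom D E := SFun D E
  id _ := SFun.id
  comp f g := g.comp f

/-- A category with ordered hom-sets. -/
class OCat (C : Type 1) extends Category.{0} C where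
  homOrder : ∀ X Y : C, PartialOrder (X ⟶ Y)

attribute [reducible, instance] OCat.homOrder

/-- A morphism of domains as a function. -/
abbrev app {D E : Dom} (f : D ⟶ E) : SFun D E := f

instance : OCat Dom where
  homOrder D E := inferInstanceAs (PartialOrder (SFun D E))

instance {I : Type} : OCat (I → Dom) where
  homOrder X Y := inferInstanceAs (PartialOrder (∀ i, SFun (X i) (Y i)))

instance instOCatProd {C D : Type 1} [OCat C] [OCat D] : OCat (C × D) where
  homOrder X Y := inferInstanceAs (PartialOrder ((X.1 ⟶ Y.1) × (X.2 ⟶ Y.2)))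

/-- The category with one morphism. -/
instance instOCatPUnit : OCat PUnit.{2} where
  Hom _ _ := PUnit
  id _ := ⟨⟩
  comp _ _ := ⟨⟩
  homOrder _ _ := inferInstanceAs (PartialOrder PUnit)

/-- Functors that are monotone on hom-sets. The functors denoted by types are in fact locally
continuous; the constructions below need monotonicity only. -/
structure OFun (C D : Type 1) [OCat C] [OCat D] extends C ⥤ D where
  mono : ∀ {X Y : C} (f g : X ⟶ Y), f ≤ g → map f ≤ map g

namespace SFun

variable {D E D' E' : Dom}

/-- `f_⊥` -/
def lift {α β : Type} [PartialOrder α] [PartialOrder β] [DirComplete α] (f : CFun α β) :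
    SFun (WithBot α) (WithBot β) :=
  ⟨⟨liftExt fun x => (f x : WithBot β), scott_liftExt (by fun_prop)⟩, rfl⟩

def prod (f : SFun D E) (g : SFun D' E') : SFun (D × D') (E × E') :=
  ⟨⟨fun x => (f x.1, g x.2), by fun_prop⟩, Prod.ext f.strict g.strict⟩

def pi {I : Type} {D E : I → Dom} (f : ∀ i, SFun (D i) (E i)) : SFun (∀ i, D i) (∀ i, E i) :=
  ⟨⟨fun x i => f i (x i), scott_pi fun i => by fun_prop⟩, funext fun i => (f i).strict⟩

/-- The action of disjoint unions on morphisms. -/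
def sigma {I : Type} {D E : I → Dom} (f : ∀ i, SFun (D i) (E i)) :
    CFun (Σ i, D i) (Σ i, E i) :=
  ⟨fun x => ⟨x.1, f x.1 x.2⟩, scott_sigma fun i =>
    (f i).cont.comp (scott_sigma_mk (D := fun i => E i) i)⟩

end SFun

namespace OFun

variable {C D E : Type 1} [OCat C] [OCat D] [OCat E]

def comp (F : OFun D E) (T : OFun C D) : OFun C E where
  toFunctor := T.toFunctor ⋙ F.toFunctor
  mono f g h := F.mono _ _ (T.mono f g h)

def id : OFun C C where
  toFunctor := 𝟭 C
  mono _ _ h := h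

def fst : OFun (C × D) C where
  obj X := X.1
  map f := f.1
  mono _ _ h := h.1

def snd : OFun (C × D) D where
  obj X := X.2
  map f := f.2
  mono _ _ h := h.2

def pair (F : OFun C D) (G : OFun C E) : OFun C (D × E) where
  obj X := (F.obj X, G.obj X)
  map f := (F.map f, G.map f)
  map_id X := Prod.ext (F.map_id X) (G.map_id X)
  map_comp f g := Prod.ext (F.map_comp f g) (G.map_comp f g)
  mono f g h := ⟨F.mono f g h, G.mono f g h⟩

/-- The functor into the terminal category. -/
def toUnit : OFun C PUnit.{2} where
  obj _ := ⟨⟩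
  map _ := ⟨⟩
  mono _ _ _ := le_rfl

/-- Tuples of functors. -/
def tuple {I : Type} (F : I → OFun C Dom) : OFun C (I → Dom) where
  obj X i := (F i).obj X
  map f i := (F i).map f
  map_id X := funext fun i => (F i).map_id X
  map_comp f g := funext fun i => (F i).map_comp f g
  mono f g h i := (F i).mono f g h

/-- The `i`-th component. -/
def eval {I : Type} (i : I) : OFun (I → Dom) Dom where
  obj X := X i
  map f := f i
  mono _ _ h := h i

def const (D : Dom) : OFun C Dom where
  obj _ := D
  map _ := 𝟙 D
  mono _ _ _ := le_rfl

theorem map_id_apply (F : OFun C Dom) (X : C) (x : F.obj X) : app (F.map (𝟙 X)) x = x := by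
  rw [F.map_id]
  rfl

theorem map_comp_apply (F : OFun C Dom) {X Y Z : C} (f : X ⟶ Y) (g : Y ⟶ Z) (x : F.obj X) :
    app (F.map (f ≫ g)) x = app (F.map g) (app (F.map f) x) := by
  rw [F.map_comp]
  rfl

def prodF (F G : OFun C Dom) : OFun C Dom where
  obj X := Dom.prod (F.obj X) (G.obj X)
  map f := SFun.prod (F.map f) (G.map f)
  map_id X := SFun.ext fun x => Prod.ext (F.map_id_apply X x.1) (G.map_id_apply X x.2)
  map_comp f g := SFun.ext fun x =>
    Prod.ext (F.map_comp_apply f g x.1) (G.map_comp_apply f g x.2)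
  mono f g h x := ⟨F.mono f g h x.1, G.mono f g h x.2⟩

def piF {I : Type} (F : I → OFun C Dom) : OFun C Dom where
  obj X := Dom.pi fun i => (F i).obj X
  map f := SFun.pi fun i => (F i).map f
  map_id X := SFun.ext fun x => funext fun i => (F i).map_id_apply X (x i)
  map_comp f g := SFun.ext fun x => funext fun i => (F i).map_comp_apply f g (x i)
  mono f g h x i := (F i).mono f g h (x i)

def liftF (F : OFun C Dom) : OFun C Dom where
  obj X := Dom.lift (F.obj X)
  map f := SFun.lift (app (F.map f)).toCFun
  map_id X := SFun.ext fun (x : WithBot _) => by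
    induction x using WithBot.recBotCoe with
    | bot => rfl
    | coe x => exact congrArg _ (F.map_id_apply X x)
  map_comp f g := SFun.ext fun (x : WithBot _) => by
    induction x using WithBot.recBotCoe with
    | bot => rfl
    | coe x => exact congrArg _ (F.map_comp_apply f g x)
  mono f g h (x : WithBot _) := by
    induction x using WithBot.recBotCoe with
    | bot => exact le_rfl
    | coe x => exact WithBot.coe_le_coe.mpr (F.mono f g h x)

def sumF {I : Type} (F : I → OFun C Dom) : OFun C Dom where
  obj X := Dom.sum fun i => (F i).obj X
  map f := SFun.lift (SFun.sigma fun i => (F i).map f)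
  map_id X := SFun.ext fun (x : WithBot _) => by
    induction x using WithBot.recBotCoe with
    | bot => rfl
    | coe x =>
      exact congrArg (fun y => (WithBot.some ⟨x.1, y⟩ : WithBot (Σ i, (F i).obj X)))
        ((F x.1).map_id_apply X x.2)
  map_comp {_ _ Z} f g := SFun.ext fun (x : WithBot _) => by
    induction x using WithBot.recBotCoe with
    | bot => rfl
    | coe x =>
      exact congrArg (fun y => (WithBot.some ⟨x.1, y⟩ : WithBot (Σ i, (F i).obj Z)))
        ((F x.1).map_comp_apply f g x.2)
  mono f g h (x : WithBot _) := by
    induction x using WithBot.recBotCoe with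
    | bot => exact le_rfl
    | coe x => exact WithBot.coe_le_coe.mpr (Sigma.mk_le_mk_iff.mpr ((F x.1).mono f g h x.2))

end OFun

/-! ### Recursive domain equations

Let `F` be an `I`-indexed family of functors `(I → Dom) × C ⥤ Dom`. For every parameter `ξ`, the
canonical solution of `X ≅ F (X, ξ)` is the limit of the chain of projections
`1 ← F (1, ξ) ← F (F (1, ξ), ξ) ← ⋯`, computed in all components `q : I` simultaneously. -/

namespace Rec

variable {I : Type} {C : Type 1} [OCat C] (F : I → OFun ((I → Dom) × C) Dom)

/-- `X₀ = 1` and `Xₙ₊₁ = F (Xₙ, ξ)`. -/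
def stage (ξ : C) (n : ℕ) : I → Dom :=
  Nat.rec (fun _ => Dom.unit) (fun _ X q => (F q).obj (X, ξ)) n

/-- The projections `Xₙ₊₁ ⟶ Xₙ`. The endomorphism `e` of the parameter is always an identity; it
is an argument because reindexing along a functor `T` turns `𝟙 ξ` into `T.map (𝟙 ξ)`. -/
def prj (ξ : C) (e : ξ ⟶ ξ) (n : ℕ) : stage F ξ (n + 1) ⟶ stage F ξ n :=
  Nat.rec (motive := fun n => stage F ξ (n + 1) ⟶ stage F ξ n)
    (fun _ => (⊥ : SFun _ PUnit))
    (fun n p q => (F q).map ((p, e) : (stage F ξ (n + 1), ξ) ⟶ (stage F ξ n, ξ))) n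

/-- Threads through the chain of projections. -/
abbrev Thread (ξ : C) (e : ξ ⟶ ξ) (q : I) : Type :=
  {x : ∀ n, stage F ξ n q // ∀ n, app (prj F ξ e n q) (x (n + 1)) = x n}

instance (ξ : C) (e : ξ ⟶ ξ) (q : I) : OrderBot (Thread F ξ e q) where
  bot := ⟨fun _ => ⊥, fun n => (app (prj F ξ e n q)).strict⟩
  bot_le _ := fun _ => bot_le

theorem exists_thread_lub (ξ : C) (e : ξ ⟶ ξ) (q : I) (s : Set (Thread F ξ e q))
    (hs : s.Nonempty) (hd : DirectedOn (· ≤ ·) s) :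
    ∃ x : Thread F ξ e q, ∀ n, IsLUB ((fun y : Thread F ξ e q => y.1 n) '' s) (x.1 n) := by
  have hdn : ∀ n, DirectedOn (· ≤ ·) ((fun y : Thread F ξ e q => y.1 n) '' s) := fun n =>
    directedOn_image_of_monotone (f := fun y : Thread F ξ e q => y.1 n)
      (fun x y (h : x ≤ y) => h n) hd
  have h : ∀ n, ∃ x, IsLUB ((fun y : Thread F ξ e q => y.1 n) '' s) x := fun n =>
    DirComplete.exists_lub _ (hs.image _) (hdn n)
  choose x hx using h
  refine ⟨⟨x, fun n => ?_⟩, hx⟩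
  have h1 := (app (prj F ξ e n q)).cont (hs.image _) (hdn (n + 1)) (hx (n + 1))
  rw [Set.image_image] at h1
  have h2 : (fun y : Thread F ξ e q => (app (prj F ξ e n q)).toFun (y.1 (n + 1))) =
      fun y => y.1 n := funext fun y => y.2 n
  rw [h2] at h1
  exact h1.unique (hx n)

theorem isLUB_thread {ξ : C} {e : ξ ⟶ ξ} {q : I} {s : Set (Thread F ξ e q)}
    {x : Thread F ξ e q}
    (h : ∀ n, IsLUB ((fun y : Thread F ξ e q => y.1 n) '' s) (x.1 n)) : IsLUB s x :=
  ⟨fun y hy n => (h n).1 ⟨y, hy, rfl⟩, fun z hz n => (h n).2 (by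
    rintro _ ⟨y, hy, rfl⟩
    exact hz hy n)⟩

instance (ξ : C) (e : ξ ⟶ ξ) (q : I) : DirComplete (Thread F ξ e q) where
  exists_lub s hs hd :=
    let ⟨x, hx⟩ := exists_thread_lub F ξ e q s hs hd
    ⟨x, isLUB_thread F hx⟩

/-- The limit of the chain of projections. -/
abbrev lim (ξ : C) (e : ξ ⟶ ξ) (q : I) : Dom := ⟨Thread F ξ e q⟩

/-- The limit projections. -/
def proj (ξ : C) (e : ξ ⟶ ξ) (n : ℕ) : lim F ξ e ⟶ stage F ξ n := fun q =>
  (⟨⟨fun x : Thread F ξ e q => x.1 n, by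
    intro s hs hd a ha
    obtain ⟨x, hx⟩ := exists_thread_lub F ξ e q s hs hd
    rw [ha.unique (isLUB_thread F hx)]
    exact hx n⟩, rfl⟩ : SFun (Thread F ξ e q) (stage F ξ n q))

/-- The map into the limit given by compatible maps into the stages. -/
def toLim {ξ : C} {e : ξ ⟶ ξ} {q : I} {D : Dom} (f : ∀ n, SFun D (stage F ξ n q))
    (hf : ∀ n x, app (prj F ξ e n q) (f (n + 1) x) = f n x) : SFun D (lim F ξ e q) where
  toFun x := ⟨fun n => f n x, fun n => hf n x⟩
  cont s hs hd a ha := isLUB_thread F fun n => by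
    rw [Set.image_image]
    exact (f n).cont hs hd ha
  strict := Subtype.ext (funext fun n => (f n).strict)

/-- The action of a morphism of parameters on the stages. -/
def stageMap {ξ ξ' : C} (f : ξ ⟶ ξ') (n : ℕ) : stage F ξ n ⟶ stage F ξ' n :=
  Nat.rec (motive := fun n => stage F ξ n ⟶ stage F ξ' n)
    (fun _ => (SFun.id : SFun PUnit PUnit))
    (fun n p q => (F q).map ((p, f) : (stage F ξ n, ξ) ⟶ (stage F ξ' n, ξ'))) n

theorem prj_stageMap {ξ ξ' : C} (f : ξ ⟶ ξ') (e : ξ ⟶ ξ) (e' : ξ' ⟶ ξ') (h : e ≫ f = f ≫ e')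
    (n : ℕ) : prj F ξ e n ≫ stageMap F f n = stageMap F f (n + 1) ≫ prj F ξ' e' n := by
  induction n with
  | zero => rfl
  | succ n ih =>
    funext q
    refine ((F q).map_comp _ _).symm.trans (Eq.trans ?_ ((F q).map_comp _ _))
    exact congrArg _ (Prod.ext ih h)

def limMap {ξ ξ' : C} (f : ξ ⟶ ξ') (e : ξ ⟶ ξ) (e' : ξ' ⟶ ξ') (h : e ≫ f = f ≫ e') (q : I) :
    SFun (lim F ξ e q) (lim F ξ' e' q) :=
  toLim F (fun n => (app (stageMap F f n q)).comp (app (proj F ξ e n q))) fun n x => by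
    have := congrArg (fun g => app (g q) (x.1 (n + 1))) (prj_stageMap F f e e' h n)
    exact this.symm.trans (congrArg (app (stageMap F f n q)) (x.2 n))

theorem stageMap_id (ξ : C) (n : ℕ) : stageMap F (𝟙 ξ) n = 𝟙 (stage F ξ n) := by
  induction n with
  | zero => rfl
  | succ n ih =>
    funext q
    have h : ((stageMap F (𝟙 ξ) n, 𝟙 ξ) : (stage F ξ n, ξ) ⟶ (stage F ξ n, ξ)) =
      𝟙 (stage F ξ n, ξ) := Prod.ext ih rfl
    exact (congrArg (F q).map h).trans ((F q).map_id (stage F ξ n, ξ))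

theorem stageMap_comp {ξ ξ' ξ'' : C} (f : ξ ⟶ ξ') (g : ξ' ⟶ ξ'') (n : ℕ) :
    stageMap F (f ≫ g) n = stageMap F f n ≫ stageMap F g n := by
  induction n with
  | zero => rfl
  | succ n ih =>
    funext q
    have h := congrArg (fun k : stage F ξ n ⟶ stage F ξ'' n =>
      (F q).map ((k, f ≫ g) : (stage F ξ n, ξ) ⟶ (stage F ξ'' n, ξ''))) ih
    exact h.trans ((F q).map_comp
      ((stageMap F f n, f) : (stage F ξ n, ξ) ⟶ (stage F ξ' n, ξ'))
      ((stageMap F g n, g) : (stage F ξ' n, ξ') ⟶ (stage F ξ'' n, ξ'')))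

theorem stageMap_mono {ξ ξ' : C} (f g : ξ ⟶ ξ') (h : f ≤ g) (n : ℕ) :
    stageMap F f n ≤ stageMap F g n := by
  induction n with
  | zero => exact le_rfl
  | succ n ih => exact fun q => (F q).mono _ _ ⟨ih, h⟩

variable {C' : Type 1} [OCat C']

/-- The solution as a functor of a parameter `T X`. -/
def solGen (T : OFun C' C) (e : ∀ X, T.obj X ⟶ T.obj X) (he : ∀ X, e X = 𝟙 (T.obj X)) (q : I) :
    OFun C' Dom where
  obj X := lim F (T.obj X) (e X) q
  map {X Y} f := limMap F (T.map f) (e X) (e Y) (by simp [he]) q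
  map_id X := SFun.ext fun x => Subtype.ext <| funext fun n => by
    refine (congrArg (fun g => app (stageMap F g n q) (x.1 n)) (T.map_id X)).trans ?_
    exact congrArg (fun g => app (g q) (x.1 n)) (stageMap_id F (T.obj X) n)
  map_comp f g := SFun.ext fun x => Subtype.ext <| funext fun n => by
    refine (congrArg (fun g => app (stageMap F g n q) (x.1 n)) (T.map_comp f g)).trans ?_
    exact congrArg (fun g => app (g q) (x.1 n)) (stageMap_comp F (T.map f) (T.map g) n)
  mono f g h x n := stageMap_mono F _ _ (T.mono f g h) n q (x.1 n)

/-- The parametrised solution `ξ ↦ FIX (F (-, ξ))`, in component `q`. -/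
def sol (q : I) : OFun C Dom := solGen F OFun.id (fun X => 𝟙 X) (fun _ => rfl) q

/-- The parameter identity. -/
theorem sol_comp (T : OFun C' C) (q : I) :
    (sol F q).comp T =
      sol (fun q => (F q).comp (OFun.pair OFun.fst (T.comp OFun.snd))) q := by
  have h : ∀ (e e' : ∀ X, T.obj X ⟶ T.obj X) he he', solGen F T e he q = solGen F T e' he' q := by
    intro e e' he he'
    obtain rfl : e = e' := funext fun X => (he X).trans (he' X).symm
    rfl
  exact h (fun X => 𝟙 _) (fun X => T.map (𝟙 X)) (fun _ => rfl) (fun X => T.map_id X)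

/-! The isomorphism `F (X, ξ) ≅ X`, where `X` is the solution at `ξ`. -/

variable (ξ : C)

/-- `Fold y` is the thread with components `F (πₙ, ξ) y`. -/
def fold (q : I) : SFun ((F q).obj (lim F ξ (𝟙 ξ), ξ)) (lim F ξ (𝟙 ξ) q) :=
  toLim F
    (fun n => match n with
      | 0 => (⊥ : SFun _ PUnit)
      | n + 1 => app ((F q).map
          ((proj F ξ (𝟙 ξ) n, 𝟙 ξ) : (lim F ξ (𝟙 ξ), ξ) ⟶ (stage F ξ n, ξ))))
    (fun n x => match n with
      | 0 => rfl
      | n + 1 => by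
        refine ((F q).map_comp_apply _ _ x).symm.trans ?_
        refine congrArg (fun g => app ((F q).map g) x) (Prod.ext ?_ (Category.comp_id _))
        exact funext fun q => SFun.ext fun y => y.2 n)

/-- The embeddings `ιₙ` of the stages into the limit: `ιₙ₊₁ = Fold ∘ F (ιₙ, ξ)`. -/
def emb : ∀ n, stage F ξ n ⟶ lim F ξ (𝟙 ξ)
  | 0 => fun q => (⊥ : SFun PUnit (Thread F ξ (𝟙 ξ) q))
  | n + 1 => fun q => (fold F ξ q).comp (app ((F q).map
      ((emb n, 𝟙 ξ) : (stage F ξ n, ξ) ⟶ (lim F ξ (𝟙 ξ), ξ))))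

/-- `F (ιₙ, ξ) ∘ πₙ₊₁` -/
def unfoldApprox (q : I) (n : ℕ) : SFun (lim F ξ (𝟙 ξ) q) ((F q).obj (lim F ξ (𝟙 ξ), ξ)) :=
  (app ((F q).map ((emb F ξ n, 𝟙 ξ) : (stage F ξ n, ξ) ⟶ (lim F ξ (𝟙 ξ), ξ)))).comp
    (app (proj F ξ (𝟙 ξ) (n + 1) q))

theorem emb_mono (n : ℕ) : prj F ξ (𝟙 ξ) n ≫ emb F ξ n ≤ emb F ξ (n + 1) := by
  induction n with
  | zero => exact fun q x => bot_le
  | succ n ih =>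
    intro q x
    refine (fold F ξ q).mono (le_of_eq_of_le ?_ ((F q).mono
      ((prj F ξ (𝟙 ξ) n ≫ emb F ξ n, 𝟙 ξ) : (stage F ξ (n + 1), ξ) ⟶ (lim F ξ (𝟙 ξ), ξ))
      (emb F ξ (n + 1), 𝟙 ξ) ⟨ih, le_rfl⟩ x))
    refine ((F q).map_comp_apply _ _ x).symm.trans ?_
    exact congrArg (fun g => app ((F q).map g) x) (Prod.ext rfl (Category.comp_id _))

theorem unfoldApprox_mono (q : I) : Monotone (unfoldApprox F ξ q) := by
  refine monotone_nat_of_le_succ fun n x => ?_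
  refine le_of_eq_of_le ?_ ((F q).mono
      ((prj F ξ (𝟙 ξ) n ≫ emb F ξ n, 𝟙 ξ) : (stage F ξ (n + 1), ξ) ⟶ (lim F ξ (𝟙 ξ), ξ))
      (emb F ξ (n + 1), 𝟙 ξ) ⟨emb_mono F ξ n, le_rfl⟩ (x.1 (n + 2)))
  refine (congrArg (app ((F q).map _)) (x.2 (n + 1)).symm).trans ?_
  refine ((F q).map_comp_apply _ _ _).symm.trans ?_
  exact congrArg (fun g => app ((F q).map g) _) (Prod.ext rfl (Category.comp_id _))

theorem exists_unfold (q : I) : ∃ f, IsLUB (Set.range (unfoldApprox F ξ q)) f :=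
  DirComplete.exists_lub _ (Set.range_nonempty _)
    (directedOn_range.mpr (unfoldApprox_mono F ξ q).directed_le)

/-- `Unfold = ⨆ₙ F (ιₙ, ξ) ∘ πₙ₊₁` -/
noncomputable def unfold (q : I) : SFun (lim F ξ (𝟙 ξ) q) ((F q).obj (lim F ξ (𝟙 ξ), ξ)) :=
  (exists_unfold F ξ q).choose

end Rec

/-! ### Types

Type variables are de Bruijn indices into a context of polarities. A value of `STy Ξ p` is a
derivation of `Ξ ⊢ A type^p`, and a value of `FTy` is a derivation of `τ type_f`. -/

/-- Polarities of types, also used for the two aspects of a type. -/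
inductive Pol
  | neg
  | pos

/-- A variable of polarity `p` in a context of type variables. -/
inductive TVar : List Pol → Pol → Type
  | zero {Ξ : List Pol} {p : Pol} : TVar (p :: Ξ) p
  | succ {Ξ : List Pol} {p q : Pol} (x : TVar Ξ p) : TVar (q :: Ξ) p

mutual

/-- Functional types. In `quoted n p A p₀ A₀`, the type of processes that provide `A₀` and use
`A 0, …, A (n - 1)`, channel names are bound, hence replaced by positions. -/
inductive FTy : Type
  | quoted (n : ℕ) (p : Fin n → Pol) (A : ∀ i, STy [] (p i)) (p₀ : Pol) (A₀ : STy [] p₀) : FTy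
  | arrow (τ σ : FTy) : FTy

/-- Session types. Labels are natural numbers. -/
inductive STy : List Pol → Pol → Type
  | one {Ξ : List Pol} : STy Ξ .pos
  | var {Ξ : List Pol} {p : Pol} (x : TVar Ξ p) : STy Ξ p
  | mu {Ξ : List Pol} {p : Pol} (A : STy (p :: Ξ) p) : STy Ξ p
  | down {Ξ : List Pol} (A : STy Ξ .neg) : STy Ξ .pos
  | up {Ξ : List Pol} (A : STy Ξ .pos) : STy Ξ .neg
  | plus {Ξ : List Pol} (L : Finset ℕ) (A : L → STy Ξ .pos) : STy Ξ .pos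
  | amp {Ξ : List Pol} (L : Finset ℕ) (A : L → STy Ξ .neg) : STy Ξ .neg
  | tensor {Ξ : List Pol} (A B : STy Ξ .pos) : STy Ξ .pos
  | lolly {Ξ : List Pol} (A : STy Ξ .pos) (B : STy Ξ .neg) : STy Ξ .neg
  | and {Ξ : List Pol} (τ : FTy) (A : STy Ξ .pos) : STy Ξ .pos
  | imp {Ξ : List Pol} (τ : FTy) (A : STy Ξ .neg) : STy Ξ .neg

end

/-- Renamings. -/
abbrev Ren (Ξ Θ : List Pol) : Type := ∀ p, TVar Ξ p → TVar Θ p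

def Ren.lift {Ξ Θ : List Pol} {q : Pol} (r : Ren Ξ Θ) : Ren (q :: Ξ) (q :: Θ)
  | _, .zero => .zero
  | _, .succ x => .succ (r _ x)

def STy.rename : {Ξ Θ : List Pol} → {p : Pol} → Ren Ξ Θ → STy Ξ p → STy Θ p
  | _, _, _, _, .one => .one
  | _, _, _, r, .var x => .var (r _ x)
  | _, _, _, r, .mu A => .mu (A.rename r.lift)
  | _, _, _, r, .down A => .down (A.rename r)
  | _, _, _, r, .up A => .up (A.rename r)
  | _, _, _, r, .plus L A => .plus L fun l => (A l).rename r
  | _, _, _, r, .amp L A => .amp L fun l => (A l).rename r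
  | _, _, _, r, .tensor A B => .tensor (A.rename r) (B.rename r)
  | _, _, _, r, .lolly A B => .lolly (A.rename r) (B.rename r)
  | _, _, _, r, .and τ A => .and τ (A.rename r)
  | _, _, _, r, .imp τ A => .imp τ (A.rename r)

/-- Substitutions. -/
abbrev Sub (Ξ Θ : List Pol) : Type := ∀ p, TVar Ξ p → STy Θ p

def Sub.lift {Ξ Θ : List Pol} {q : Pol} (s : Sub Ξ Θ) : Sub (q :: Ξ) (q :: Θ)
  | _, .zero => .var .zero
  | _, .succ x => (s _ x).rename fun _ => .succ

def STy.subst : {Ξ Θ : List Pol} → {p : Pol} → Sub Ξ Θ → STy Ξ p → STy Θ p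
  | _, _, _, _, .one => .one
  | _, _, _, s, .var x => s _ x
  | _, _, _, s, .mu A => .mu (A.subst s.lift)
  | _, _, _, s, .down A => .down (A.subst s)
  | _, _, _, s, .up A => .up (A.subst s)
  | _, _, _, s, .plus L A => .plus L fun l => (A l).subst s
  | _, _, _, s, .amp L A => .amp L fun l => (A l).subst s
  | _, _, _, s, .tensor A B => .tensor (A.subst s) (B.subst s)
  | _, _, _, s, .lolly A B => .lolly (A.subst s) (B.subst s)
  | _, _, _, s, .and τ A => .and τ (A.subst s)
  | _, _, _, s, .imp τ A => .imp τ (A.subst s)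

/-- The substitution `[A/α]`. -/
def Sub.single {p : Pol} (A : STy [] p) : Sub [p] []
  | _, .zero => A

/-- `[ρα.A/α]A` -/
def STy.unroll {p : Pol} (A : STy [p] p) : STy [] p := A.subst (Sub.single A.mu)

/-! ### Denotations of types

A type variable denotes a pair of domains, one for each aspect; a session type `A` denotes two
functors `⟦A⟧⁻` and `⟦A⟧⁺` of the domains of its variables. Both aspects of `A` can occur in one
aspect of a type built from `A` (namely in `A ⊸ B`), hence the recursive type `ρα.A` denotes the
pair that solves both domain equations `X^q ≅ ⟦A⟧^q (X, ξ)` simultaneously. -/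

/-- `⟦Ξ⟧` -/
def Env : List Pol → Type 1
  | [] => PUnit
  | _ :: Ξ => (Pol → Dom) × Env Ξ

instance instOCatEnv (Ξ : List Pol) : OCat (Env Ξ) :=
  List.rec (motive := fun Ξ => OCat (Env Ξ)) instOCatPUnit
    (fun _ Ξ c => @instOCatProd (Pol → Dom) (Env Ξ) _ c) Ξ

/-- `π_α`, in aspect `q`. -/
def TVar.den : {Ξ : List Pol} → {p : Pol} → TVar Ξ p → Pol → OFun (Env Ξ) Dom
  | _ :: Ξ, _, .zero, q => (OFun.eval q).comp (OFun.fst (D := Env Ξ))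
  | _ :: Ξ, _, .succ x, q => (x.den q).comp (OFun.snd (C := Pol → Dom) (D := Env Ξ))

/-- The two aspects of `⊕`. -/
def plusDen {I : Type} {C : Type 1} [OCat C] (F : I → Pol → OFun C Dom) : Pol → OFun C Dom
  | .neg => OFun.piF fun l => F l .neg
  | .pos => OFun.sumF fun l => F l .pos

/-- The two aspects of `&`. -/
def ampDen {I : Type} {C : Type 1} [OCat C] (F : I → Pol → OFun C Dom) : Pol → OFun C Dom
  | .neg => OFun.sumF fun l => F l .neg
  | .pos => OFun.piF fun l => F l .pos

open Dom in
mutual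

def FTy.den : FTy → Dom
  | .quoted _ _ A _ A₀ =>
    lift (fn (prod (pi fun i => ((A i).den .pos).obj ⟨⟩) ((A₀.den .neg).obj ⟨⟩))
      (prod (pi fun i => ((A i).den .neg).obj ⟨⟩) ((A₀.den .pos).obj ⟨⟩)))
  | .arrow τ σ => sfn τ.den σ.den

def STy.den : {Ξ : List Pol} → {p : Pol} → STy Ξ p → Pol → OFun (Env Ξ) Dom
  | _, _, .one => fun
    | .neg => OFun.const unit
    | .pos => OFun.const (lift PUnit)
  | _, _, .var x => x.den
  | Ξ, _, .mu A => Rec.sol (C := Env Ξ) fun q => A.den q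
  | _, _, .down A => fun
    | .neg => A.den .neg
    | .pos => (A.den .pos).liftF
  | _, _, .up A => fun
    | .neg => (A.den .neg).liftF
    | .pos => A.den .pos
  | _, _, .plus _ A => plusDen fun l q => (A l).den q
  | _, _, .amp _ A => ampDen fun l q => (A l).den q
  | _, _, .tensor A B => fun
    | .neg => (A.den .neg).prodF (B.den .neg)
    | .pos => ((A.den .pos).prodF (B.den .pos)).liftF
  | _, _, .lolly A B => fun
    | .neg => ((A.den .pos).prodF (B.den .neg)).liftF
    | .pos => (A.den .neg).prodF (B.den .pos)
  | _, _, .and τ A => fun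
    | .neg => A.den .neg
    | .pos => ((OFun.const τ.den).prodF (A.den .pos)).liftF
  | _, _, .imp τ A => fun
    | .neg => ((OFun.const τ.den).prodF (A.den .neg)).liftF
    | .pos => A.den .pos

end

/-- `⟦A⟧^q` for a closed session type `A`. -/
abbrev STy.dom {p : Pol} (A : STy [] p) (q : Pol) : Dom := (A.den q).obj ⟨⟩

/-! Substitution is composition. -/

def Sub.den : {Ξ Θ : List Pol} → Sub Ξ Θ → OFun (Env Θ) (Env Ξ)
  | [], _, _ => OFun.toUnit
  | _ :: Ξ, _, s => OFun.pair (E := Env Ξ) (OFun.tuple fun q => (s _ .zero).den q)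
      (Sub.den fun p x => s p (.succ x))

theorem Sub.den_weaken {q : Pol} : ∀ {Ξ Θ : List Pol} (s : Sub Ξ Θ) (s' : Sub Ξ (q :: Θ)),
    (∀ p x a, (s' p x).den a =
      ((s p x).den a).comp (OFun.snd (C := Pol → Dom) (D := Env Θ))) →
    Sub.den s' = (Sub.den s).comp (OFun.snd (C := Pol → Dom) (D := Env Θ))
  | [], _, _, _, _ => rfl
  | p :: Ξ, Θ, s, s', h => by
    have h1 := Sub.den_weaken (fun p x => s p (.succ x)) (fun p x => s' p (.succ x))
      fun p x a => h p (.succ x) a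
    have h2 : (fun a => (s' _ .zero).den a) = fun a => ((s p .zero).den a).comp
        (OFun.snd (C := Pol → Dom) (D := Env Θ)) := funext fun a => h p .zero a
    simp only [Sub.den, h1, h2]
    rfl

/-- `T × id` on environments with one more variable. -/
def OFun.underBinder {Ξ Θ : List Pol} (T : OFun (Env Θ) (Env Ξ)) :
    OFun ((Pol → Dom) × Env Θ) ((Pol → Dom) × Env Ξ) :=
  OFun.pair OFun.fst (T.comp OFun.snd)

theorem TVar.den_sub : ∀ {Ξ Θ : List Pol} {p : Pol} (s : Sub Ξ Θ) (x : TVar Ξ p) (q : Pol),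
    (s p x).den q = (x.den q).comp (Sub.den s)
  | _, _, _, _, .zero, _ => rfl
  | _, _, _, s, .succ x, q => TVar.den_sub (fun p x => s p (.succ x)) x q

theorem Ren.den_lift {Ξ Θ : List Pol} {q : Pol} (r : Ren Ξ Θ) :
    Sub.den (fun p x => .var (r.lift (q := q) p x)) =
      (Sub.den fun p x => .var (r p x)).underBinder := by
  have h := Sub.den_weaken (q := q) (fun p x => .var (r p x)) (fun p x => .var (.succ (r p x)))
    fun _ _ _ => rfl
  exact congrArg (OFun.pair (E := Env Ξ) OFun.fst) h

theorem STy.den_rename : ∀ {Ξ Θ : List Pol} {p : Pol} (r : Ren Ξ Θ) (A : STy Ξ p) (q : Pol),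
    (A.rename r).den q = (A.den q).comp (Sub.den fun p x => .var (r p x))
  | _, _, _, _, .one, .neg => rfl
  | _, _, _, _, .one, .pos => rfl
  | _, _, _, r, .var x, q => TVar.den_sub (fun p x => .var (r p x)) x q
  | _, _, _, r, .mu A, q => by
    refine Eq.trans ?_ (Rec.sol_comp _ _ q).symm
    refine congrArg (fun F => Rec.sol F q) (funext fun a => ?_)
    exact (den_rename r.lift A a).trans (congrArg (A.den a).comp r.den_lift)
  | _, _, _, r, .down A, .neg => den_rename r A .neg
  | _, _, _, r, .down A, .pos => congrArg OFun.liftF (den_rename r A .pos)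
  | _, _, _, r, .up A, .neg => congrArg OFun.liftF (den_rename r A .neg)
  | _, _, _, r, .up A, .pos => den_rename r A .pos
  | _, _, _, r, .plus L A, .neg =>
    congrArg OFun.piF (funext fun l => den_rename r (A l) .neg)
  | _, _, _, r, .plus L A, .pos =>
    congrArg OFun.sumF (funext fun l => den_rename r (A l) .pos)
  | _, _, _, r, .amp L A, .neg =>
    congrArg OFun.sumF (funext fun l => den_rename r (A l) .neg)
  | _, _, _, r, .amp L A, .pos =>
    congrArg OFun.piF (funext fun l => den_rename r (A l) .pos)
  | _, _, _, r, .tensor A B, .neg =>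
    congrArg₂ OFun.prodF (den_rename r A .neg) (den_rename r B .neg)
  | _, _, _, r, .tensor A B, .pos =>
    congrArg₂ (fun F G => (OFun.prodF F G).liftF) (den_rename r A .pos) (den_rename r B .pos)
  | _, _, _, r, .lolly A B, .neg =>
    congrArg₂ (fun F G => (OFun.prodF F G).liftF) (den_rename r A .pos) (den_rename r B .neg)
  | _, _, _, r, .lolly A B, .pos =>
    congrArg₂ OFun.prodF (den_rename r A .neg) (den_rename r B .pos)
  | _, _, _, r, .and τ A, .neg => den_rename r A .neg
  | _, _, _, r, .and τ A, .pos =>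
    congrArg (fun F => ((OFun.const τ.den).prodF F).liftF) (den_rename r A .pos)
  | _, _, _, r, .imp τ A, .neg =>
    congrArg (fun F => ((OFun.const τ.den).prodF F).liftF) (den_rename r A .neg)
  | _, _, _, r, .imp τ A, .pos => den_rename r A .pos

theorem Sub.den_var : ∀ (Ξ : List Pol), Sub.den (fun _ x => .var x : Sub Ξ Ξ) = OFun.id
  | [] => rfl
  | q :: Ξ => by
    have h := Sub.den_weaken (q := q) (fun _ x => .var x : Sub Ξ Ξ) (fun _ x => .var (.succ x))
      fun _ _ _ => rfl
    rw [Sub.den_var Ξ] at h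
    exact congrArg (OFun.pair (E := Env Ξ) OFun.fst) h

theorem Sub.den_lift {Ξ Θ : List Pol} {q : Pol} (s : Sub Ξ Θ) :
    Sub.den (s.lift (q := q)) = (Sub.den s).underBinder := by
  have h1 := Sub.den_weaken (q := q) (fun _ x => .var x : Sub Θ Θ) (fun _ x => .var (.succ x))
    fun _ _ _ => rfl
  rw [Sub.den_var Θ] at h1
  have h := Sub.den_weaken (q := q) s (fun p x => (s p x).rename fun _ => .succ) fun p x a =>
    (STy.den_rename _ (s p x) a).trans (congrArg ((s p x).den a).comp h1)
  exact congrArg (OFun.pair (E := Env Ξ) OFun.fst) h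

theorem STy.den_subst : ∀ {Ξ Θ : List Pol} {p : Pol} (s : Sub Ξ Θ) (A : STy Ξ p) (q : Pol),
    (A.subst s).den q = (A.den q).comp (Sub.den s)
  | _, _, _, _, .one, .neg => rfl
  | _, _, _, _, .one, .pos => rfl
  | _, _, _, s, .var x, q => TVar.den_sub s x q
  | _, _, _, s, .mu A, q => by
    refine Eq.trans ?_ (Rec.sol_comp _ _ q).symm
    refine congrArg (fun F => Rec.sol F q) (funext fun a => ?_)
    exact (den_subst s.lift A a).trans (congrArg (A.den a).comp s.den_lift)
  | _, _, _, s, .down A, .neg => den_subst s A .neg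
  | _, _, _, s, .down A, .pos => congrArg OFun.liftF (den_subst s A .pos)
  | _, _, _, s, .up A, .neg => congrArg OFun.liftF (den_subst s A .neg)
  | _, _, _, s, .up A, .pos => den_subst s A .pos
  | _, _, _, s, .plus L A, .neg =>
    congrArg OFun.piF (funext fun l => den_subst s (A l) .neg)
  | _, _, _, s, .plus L A, .pos =>
    congrArg OFun.sumF (funext fun l => den_subst s (A l) .pos)
  | _, _, _, s, .amp L A, .neg =>
    congrArg OFun.sumF (funext fun l => den_subst s (A l) .neg)
  | _, _, _, s, .amp L A, .pos =>
    congrArg OFun.piF (funext fun l => den_subst s (A l) .pos)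
  | _, _, _, s, .tensor A B, .neg =>
    congrArg₂ OFun.prodF (den_subst s A .neg) (den_subst s B .neg)
  | _, _, _, s, .tensor A B, .pos =>
    congrArg₂ (fun F G => (OFun.prodF F G).liftF) (den_subst s A .pos) (den_subst s B .pos)
  | _, _, _, s, .lolly A B, .neg =>
    congrArg₂ (fun F G => (OFun.prodF F G).liftF) (den_subst s A .pos) (den_subst s B .neg)
  | _, _, _, s, .lolly A B, .pos =>
    congrArg₂ OFun.prodF (den_subst s A .neg) (den_subst s B .pos)
  | _, _, _, s, .and τ A, .neg => den_subst s A .neg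
  | _, _, _, s, .and τ A, .pos =>
    congrArg (fun F => ((OFun.const τ.den).prodF F).liftF) (den_subst s A .pos)
  | _, _, _, s, .imp τ A, .neg =>
    congrArg (fun F => ((OFun.const τ.den).prodF F).liftF) (den_subst s A .neg)
  | _, _, _, s, .imp τ A, .pos => den_subst s A .pos

/-- `⟦[ρα.A/α]A⟧^q = ⟦A⟧^q ⟦ρα.A⟧` -/
theorem STy.dom_unroll {p : Pol} (A : STy [p] p) (q : Pol) :
    A.unroll.dom q = (A.den q).obj (fun a => A.mu.dom a, ⟨⟩) :=
  congrArg (fun F => F.obj ⟨⟩) (STy.den_subst (Sub.single A.mu) A q)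

/-- Transport along an equality of domains. -/
def castDom {D E : Dom} (h : D = E) : SFun D E := app (eqToHom h)

/-- `Fold^q : ⟦[ρα.A/α]A⟧^q → ⟦ρα.A⟧^q` -/
def STy.fold {p : Pol} (A : STy [p] p) (q : Pol) : SFun (A.unroll.dom q) (A.mu.dom q) :=
  have f : (A.den q).obj (fun a => A.mu.dom a, ⟨⟩) ⟶ A.mu.dom q :=
    Rec.fold (C := Env []) (fun a => A.den a) ⟨⟩ q
  app (eqToHom (A.dom_unroll q) ≫ f)

/-- `Unfold^q : ⟦ρα.A⟧^q → ⟦[ρα.A/α]A⟧^q` -/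
def STy.unfold {p : Pol} (A : STy [p] p) (q : Pol) : SFun (A.mu.dom q) (A.unroll.dom q) :=
  have f : A.mu.dom q ⟶ (A.den q).obj (fun a => A.mu.dom a, ⟨⟩) :=
    Rec.unfold (C := Env []) (fun a => A.den a) ⟨⟩ q
  app (f ≫ eqToHom (A.dom_unroll q).symm)

/-! ### Contexts -/

/-- Closed session types. -/
abbrev SType : Type := Σ p, STy [] p

/-- `⟦A⟧^q` -/
abbrev SType.dom (A : SType) (q : Pol) : Dom := A.2.dom q

/-- Linear contexts: finitely many channels with their types. -/
structure LCtx : Type where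
  dom : Finset ℕ
  ty : dom → SType

namespace LCtx

/-- `·` -/
def empty : LCtx := ⟨∅, fun c => absurd c.2 (Finset.notMem_empty _)⟩

/-- `a : A` -/
def single (a : ℕ) (A : SType) : LCtx := ⟨{a}, fun _ => A⟩

/-- `Δ₁, Δ₂`, for contexts with disjoint domains. -/
def append (Δ₁ Δ₂ : LCtx) : LCtx where
  dom := Δ₁.dom ∪ Δ₂.dom
  ty c := if h : c.1 ∈ Δ₁.dom then Δ₁.ty ⟨c, h⟩
    else Δ₂.ty ⟨c, (Finset.mem_union.mp c.2).resolve_left h⟩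

/-- `Δ, a : A`, for `a` not in `Δ`. -/
abbrev snoc (Δ : LCtx) (a : ℕ) (A : SType) : LCtx := Δ.append (single a A)

/-- `⟦Δ⟧^q` -/
abbrev den (Δ : LCtx) (q : Pol) : Dom := Dom.pi fun c => (Δ.ty c).dom q

variable {Δ Δ₁ Δ₂ : LCtx} {q : Pol}

theorem notMem_of_snoc {a b : ℕ} {B : SType} (h : a ∉ (Δ.snoc b B).dom) : a ∉ Δ.dom :=
  fun h' => h (Finset.mem_union_left _ h')

theorem ty_left (c : Δ₁.dom) :
    (Δ₁.append Δ₂).ty ⟨c, Finset.mem_union_left _ c.2⟩ = Δ₁.ty c := dif_pos c.2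

theorem ty_right (h : Disjoint Δ₁.dom Δ₂.dom) (c : Δ₂.dom) :
    (Δ₁.append Δ₂).ty ⟨c, Finset.mem_union_right _ c.2⟩ = Δ₂.ty c :=
  dif_neg (Finset.disjoint_right.mp h c.2)

/-- `⟦Δ₁, Δ₂⟧^q → ⟦Δ₁⟧^q × ⟦Δ₂⟧^q` -/
def split (h : Disjoint Δ₁.dom Δ₂.dom) :
    CFun ((Δ₁.append Δ₂).den q) (Dom.prod (Δ₁.den q) (Δ₂.den q)) where
  toFun x :=
    (fun c => castDom (congrArg (SType.dom · q) (ty_left c)) (x ⟨c, Finset.mem_union_left _ c.2⟩),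
      fun c => castDom (congrArg (SType.dom · q) (ty_right h c))
        (x ⟨c, Finset.mem_union_right _ c.2⟩))
  cont := ScottContinuous.prodMk (scott_pi fun c => by fun_prop) (scott_pi fun c => by fun_prop)

/-- `⟦Δ₁⟧^q × ⟦Δ₂⟧^q → ⟦Δ₁, Δ₂⟧^q` -/
def join : CFun (Dom.prod (Δ₁.den q) (Δ₂.den q)) ((Δ₁.append Δ₂).den q) where
  toFun x c :=
    if h : c.1 ∈ Δ₁.dom then
      castDom (congrArg (SType.dom · q) (dif_pos h).symm) (x.1 ⟨c, h⟩)
    else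
      castDom (congrArg (SType.dom · q) (dif_neg h).symm)
        (x.2 ⟨c, (Finset.mem_union.mp c.2).resolve_left h⟩)
  cont := scott_pi fun c => by
    by_cases h : c.1 ∈ Δ₁.dom
    · refine scott_congr ?_ fun x => (dif_pos h).symm
      fun_prop
    · refine scott_congr ?_ fun x => (dif_neg h).symm
      fun_prop

/-- `⟦Δ, a : A⟧^q → ⟦Δ⟧^q × ⟦A⟧^q` -/
def splitSnoc {a : ℕ} {A : SType} (h : a ∉ Δ.dom) :
    CFun ((Δ.snoc a A).den q) (Dom.prod (Δ.den q) (A.dom q)) :=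
  CFun.comp ⟨fun x => (x.1, x.2 ⟨a, Finset.mem_singleton_self a⟩), by fun_prop⟩
    (split (Finset.disjoint_singleton_right.mpr h))

/-- `⟦Δ⟧^q × ⟦A⟧^q → ⟦Δ, a : A⟧^q` -/
def joinSnoc {a : ℕ} {A : SType} :
    CFun (Dom.prod (Δ.den q) (A.dom q)) ((Δ.snoc a A).den q) :=
  CFun.comp join ⟨fun x => (x.1, fun _ => x.2),
    ScottContinuous.prodMk (by fun_prop) (scott_pi fun _ => by fun_prop)⟩

/-- Reindexing along an enumeration of the channels. -/
def toFin {n : ℕ} (e : Fin n ≃ Δ.dom) :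
    CFun (Δ.den q) (Dom.pi fun i => (Δ.ty (e i)).dom q) :=
  ⟨fun x i => x (e i), scott_pi fun i => by fun_prop⟩

/-- The inverse of `toFin`. -/
def ofFin {n : ℕ} (e : Fin n ≃ Δ.dom) :
    CFun (Dom.pi fun i => (Δ.ty (e i)).dom q) (Δ.den q) :=
  ⟨fun x c => castDom (congrArg (fun c => (Δ.ty c).dom q) (e.apply_symm_apply c)) (x (e.symm c)),
    scott_pi fun c => by fun_prop⟩

end LCtx

/-- Functional contexts. The head of the list is the most recent variable: `(x, τ) :: Ψ` stands
for `Ψ, x : τ`, and `Ψ ++ Φ` for `Φ, Ψ`. -/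
abbrev FCtx : Type := List (ℕ × FTy)

/-- `⟦Ψ⟧` -/
def FCtx.den : FCtx → Dom
  | [] => Dom.unit
  | (_, τ) :: Ψ => Dom.prod τ.den (FCtx.den Ψ)

/-- `Lookup x τ Ψ` says that the most recent declaration of `x` in `Ψ` is `x : τ`. -/
inductive Lookup (x : ℕ) (τ : FTy) : FCtx → Type
  | here {Ψ : FCtx} : Lookup x τ ((x, τ) :: Ψ)
  | there {Ψ : FCtx} {y : ℕ} {σ : FTy} (h : x ≠ y) (l : Lookup x τ Ψ) : Lookup x τ ((y, σ) :: Ψ)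

/-- `π_x : ⟦Ψ⟧ → ⟦τ⟧` -/
def Lookup.den {x : ℕ} {τ : FTy} : {Ψ : FCtx} → Lookup x τ Ψ → CFun (FCtx.den Ψ) τ.den
  | (_, _) :: Ψ, .here => (⟨fun u => u.1, by fun_prop⟩ : CFun (Dom.prod τ.den (FCtx.den Ψ)) τ.den)
  | (_, σ) :: Ψ, .there _ l =>
    (⟨fun u => l.den u.2, by fun_prop⟩ : CFun (Dom.prod σ.den (FCtx.den Ψ)) τ.den)

def Lookup.weaken (Φ : FCtx) {x : ℕ} {τ : FTy} : {Ψ : FCtx} → Lookup x τ Ψ → Lookup x τ (Ψ ++ Φ)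
  | _, .here => .here
  | _, .there h l => .there h (l.weaken Φ)

/-- The projection `π^{Φ,Ψ}_Ψ : ⟦Φ, Ψ⟧ → ⟦Ψ⟧`. -/
def FCtx.proj (Φ : FCtx) : (Ψ : FCtx) → CFun (FCtx.den (Ψ ++ Φ)) (FCtx.den Ψ)
  | [] => (⟨fun _ => PUnit.unit, ScottContinuous.const _⟩ : CFun (FCtx.den Φ) PUnit)
  | (_, τ) :: Ψ =>
    (⟨fun u => (u.1, FCtx.proj Φ Ψ u.2), by fun_prop⟩ :
      CFun (Dom.prod τ.den (FCtx.den (Ψ ++ Φ))) (Dom.prod τ.den (FCtx.den Ψ)))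

/-! ### Terms and processes

Variables and channels are named by natural numbers. -/

mutual

inductive Tm : Type
  | var (x : ℕ)
  | lam (x : ℕ) (τ : FTy) (M : Tm)
  | app (M N : Tm)
  | fix (x : ℕ) (M : Tm)
  /-- `a ← {P} ← as` -/
  | quote (a : ℕ) (P : Pr) (as : List ℕ)

inductive Pr : Type
  /-- `a → b` -/
  | fwd (a b : ℕ)
  /-- `a ← P; Q` -/
  | cut (a : ℕ) (P Q : Pr)
  | close (a : ℕ)
  | wait (a : ℕ) (P : Pr)
  | sendShift (a : ℕ) (P : Pr)
  | recvShift (a : ℕ) (P : Pr)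
  | sendLabel (a k : ℕ) (P : Pr)
  | case (a : ℕ) (L : Finset ℕ) (P : L → Pr)
  | sendChan (a b : ℕ) (P : Pr)
  | recvChan (b a : ℕ) (P : Pr)
  | sendVal (a : ℕ) (M : Tm) (P : Pr)
  | recvVal (x a : ℕ) (P : Pr)
  | sendUnfold (a : ℕ) (P : Pr)
  | recvUnfold (a : ℕ) (P : Pr)
  /-- `a ← {M} ← as` -/
  | unquote (a : ℕ) (M : Tm) (as : List ℕ)

end

/-! Derivations. Contexts do not declare a channel twice, and the channel that a process provides
is not in its context; the side conditions say no more than that. -/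

mutual

/-- Derivations of `Ψ ⊢ M : τ`. -/
inductive HasTy : FCtx → Tm → FTy → Type
  | quote {Ψ : FCtx} {Δ : LCtx} {P : Pr} {a : ℕ} {A : SType} (d : ProcTy Ψ Δ P a A)
      {n : ℕ} (e : Fin n ≃ Δ.dom) :
      HasTy Ψ (.quote a P (List.ofFn fun i => (e i).1))
        (.quoted n (fun i => (Δ.ty (e i)).1) (fun i => (Δ.ty (e i)).2) A.1 A.2)
  | var {Ψ : FCtx} {x : ℕ} {τ : FTy} (l : Lookup x τ Ψ) : HasTy Ψ (.var x) τ
  | fix {Ψ : FCtx} {x : ℕ} {M : Tm} {τ : FTy} (d : HasTy ((x, τ) :: Ψ) M τ) :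
      HasTy Ψ (.fix x M) τ
  | lam {Ψ : FCtx} {x : ℕ} {M : Tm} {τ σ : FTy} (d : HasTy ((x, τ) :: Ψ) M σ) :
      HasTy Ψ (.lam x τ M) (.arrow τ σ)
  | app {Ψ : FCtx} {M N : Tm} {τ σ : FTy} (d : HasTy Ψ M (.arrow τ σ)) (d' : HasTy Ψ N τ) :
      HasTy Ψ (.app M N) σ

/-- Derivations of `Ψ; Δ ⊢ P :: c : C`. -/
inductive ProcTy : FCtx → LCtx → Pr → ℕ → SType → Type
  | fwd {Ψ : FCtx} {a b : ℕ} {A : SType} (hab : a ≠ b) :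
      ProcTy Ψ (.single a A) (.fwd a b) b A
  | cut {Ψ : FCtx} {Δ₁ Δ₂ : LCtx} {a c : ℕ} {A C : SType} {P Q : Pr}
      (h : Disjoint Δ₁.dom Δ₂.dom) (ha : a ∉ Δ₂.dom) (hc : c ∉ Δ₁.dom)
      (d : ProcTy Ψ Δ₁ P a A) (d' : ProcTy Ψ (Δ₂.snoc a A) Q c C) :
      ProcTy Ψ (Δ₁.append Δ₂) (.cut a P Q) c C
  | oneR {Ψ : FCtx} {a : ℕ} : ProcTy Ψ .empty (.close a) a ⟨_, .one⟩
  | oneL {Ψ : FCtx} {Δ : LCtx} {a c : ℕ} {C : SType} {P : Pr} (ha : a ∉ Δ.dom) (hac : a ≠ c)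
      (d : ProcTy Ψ Δ P c C) :
      ProcTy Ψ (Δ.snoc a ⟨_, .one⟩) (.wait a P) c C
  | downR {Ψ : FCtx} {Δ : LCtx} {a : ℕ} {A : STy [] .neg} {P : Pr}
      (d : ProcTy Ψ Δ P a ⟨_, A⟩) :
      ProcTy Ψ Δ (.sendShift a P) a ⟨_, .down A⟩
  | downL {Ψ : FCtx} {Δ : LCtx} {a c : ℕ} {A : STy [] .neg} {C : SType} {P : Pr}
      (ha : a ∉ Δ.dom) (d : ProcTy Ψ (Δ.snoc a ⟨_, A⟩) P c C) :
      ProcTy Ψ (Δ.snoc a ⟨_, .down A⟩) (.recvShift a P) c C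
  | upR {Ψ : FCtx} {Δ : LCtx} {a : ℕ} {A : STy [] .pos} {P : Pr}
      (d : ProcTy Ψ Δ P a ⟨_, A⟩) :
      ProcTy Ψ Δ (.recvShift a P) a ⟨_, .up A⟩
  | upL {Ψ : FCtx} {Δ : LCtx} {a c : ℕ} {A : STy [] .pos} {C : SType} {P : Pr}
      (ha : a ∉ Δ.dom) (d : ProcTy Ψ (Δ.snoc a ⟨_, A⟩) P c C) :
      ProcTy Ψ (Δ.snoc a ⟨_, .up A⟩) (.sendShift a P) c C
  | plusR {Ψ : FCtx} {Δ : LCtx} {a : ℕ} {L : Finset ℕ} {A : L → STy [] .pos} {P : Pr} (k : L)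
      (d : ProcTy Ψ Δ P a ⟨_, A k⟩) :
      ProcTy Ψ Δ (.sendLabel a k P) a ⟨_, .plus L A⟩
  | plusL {Ψ : FCtx} {Δ : LCtx} {a c : ℕ} {L : Finset ℕ} {A : L → STy [] .pos} {C : SType}
      {P : L → Pr} (ha : a ∉ Δ.dom) (hac : a ≠ c) (hc : c ∉ Δ.dom)
      (d : ∀ l, ProcTy Ψ (Δ.snoc a ⟨_, A l⟩) (P l) c C) :
      ProcTy Ψ (Δ.snoc a ⟨_, .plus L A⟩) (.case a L P) c C
  | ampR {Ψ : FCtx} {Δ : LCtx} {a : ℕ} {L : Finset ℕ} {A : L → STy [] .neg} {P : L → Pr}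
      (ha : a ∉ Δ.dom) (d : ∀ l, ProcTy Ψ Δ (P l) a ⟨_, A l⟩) :
      ProcTy Ψ Δ (.case a L P) a ⟨_, .amp L A⟩
  | ampL {Ψ : FCtx} {Δ : LCtx} {a c : ℕ} {L : Finset ℕ} {A : L → STy [] .neg} {C : SType}
      {P : Pr} (ha : a ∉ Δ.dom) (k : L) (d : ProcTy Ψ (Δ.snoc a ⟨_, A k⟩) P c C) :
      ProcTy Ψ (Δ.snoc a ⟨_, .amp L A⟩) (.sendLabel a k P) c C
  | tensorR {Ψ : FCtx} {Δ : LCtx} {a b : ℕ} {B A : STy [] .pos} {P : Pr}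
      (hb : b ∉ Δ.dom) (hba : b ≠ a) (d : ProcTy Ψ Δ P a ⟨_, A⟩) :
      ProcTy Ψ (Δ.snoc b ⟨_, B⟩) (.sendChan a b P) a ⟨_, .tensor B A⟩
  | tensorL {Ψ : FCtx} {Δ : LCtx} {a b c : ℕ} {B A : STy [] .pos} {C : SType} {P : Pr}
      (ha : a ∉ Δ.dom) (hb : b ∉ (Δ.snoc a ⟨_, A⟩).dom)
      (d : ProcTy Ψ ((Δ.snoc a ⟨_, A⟩).snoc b ⟨_, B⟩) P c C) :
      ProcTy Ψ (Δ.snoc a ⟨_, .tensor B A⟩) (.recvChan b a P) c C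
  | lollyR {Ψ : FCtx} {Δ : LCtx} {a b : ℕ} {B : STy [] .pos} {A : STy [] .neg} {P : Pr}
      (hb : b ∉ Δ.dom) (d : ProcTy Ψ (Δ.snoc b ⟨_, B⟩) P a ⟨_, A⟩) :
      ProcTy Ψ Δ (.recvChan b a P) a ⟨_, .lolly B A⟩
  | lollyL {Ψ : FCtx} {Δ : LCtx} {a b c : ℕ} {B : STy [] .pos} {A : STy [] .neg} {C : SType}
      {P : Pr} (hb : b ∉ Δ.dom) (ha : a ∉ (Δ.snoc b ⟨_, B⟩).dom) (hbc : b ≠ c)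
      (d : ProcTy Ψ (Δ.snoc a ⟨_, A⟩) P c C) :
      ProcTy Ψ ((Δ.snoc b ⟨_, B⟩).snoc a ⟨_, .lolly B A⟩) (.sendChan a b P) c C
  | andR {Ψ : FCtx} {Δ : LCtx} {a : ℕ} {τ : FTy} {A : STy [] .pos} {M : Tm} {P : Pr}
      (d : HasTy Ψ M τ) (d' : ProcTy Ψ Δ P a ⟨_, A⟩) :
      ProcTy Ψ Δ (.sendVal a M P) a ⟨_, .and τ A⟩
  | andL {Ψ : FCtx} {Δ : LCtx} {a c x : ℕ} {τ : FTy} {A : STy [] .pos} {C : SType} {P : Pr}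
      (ha : a ∉ Δ.dom) (d : ProcTy ((x, τ) :: Ψ) (Δ.snoc a ⟨_, A⟩) P c C) :
      ProcTy Ψ (Δ.snoc a ⟨_, .and τ A⟩) (.recvVal x a P) c C
  | impR {Ψ : FCtx} {Δ : LCtx} {a x : ℕ} {τ : FTy} {A : STy [] .neg} {P : Pr}
      (d : ProcTy ((x, τ) :: Ψ) Δ P a ⟨_, A⟩) :
      ProcTy Ψ Δ (.recvVal x a P) a ⟨_, .imp τ A⟩
  | impL {Ψ : FCtx} {Δ : LCtx} {a c : ℕ} {τ : FTy} {A : STy [] .neg} {C : SType} {M : Tm}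
      {P : Pr} (ha : a ∉ Δ.dom) (d : HasTy Ψ M τ) (d' : ProcTy Ψ (Δ.snoc a ⟨_, A⟩) P c C) :
      ProcTy Ψ (Δ.snoc a ⟨_, .imp τ A⟩) (.sendVal a M P) c C
  | muPosR {Ψ : FCtx} {Δ : LCtx} {a : ℕ} {A : STy [.pos] .pos} {P : Pr}
      (d : ProcTy Ψ Δ P a ⟨_, A.unroll⟩) :
      ProcTy Ψ Δ (.sendUnfold a P) a ⟨_, .mu A⟩
  | muPosL {Ψ : FCtx} {Δ : LCtx} {a c : ℕ} {A : STy [.pos] .pos} {C : SType} {P : Pr}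
      (ha : a ∉ Δ.dom) (d : ProcTy Ψ (Δ.snoc a ⟨_, A.unroll⟩) P c C) :
      ProcTy Ψ (Δ.snoc a ⟨_, .mu A⟩) (.recvUnfold a P) c C
  | muNegR {Ψ : FCtx} {Δ : LCtx} {a : ℕ} {A : STy [.neg] .neg} {P : Pr}
      (d : ProcTy Ψ Δ P a ⟨_, A.unroll⟩) :
      ProcTy Ψ Δ (.recvUnfold a P) a ⟨_, .mu A⟩
  | muNegL {Ψ : FCtx} {Δ : LCtx} {a c : ℕ} {A : STy [.neg] .neg} {C : SType} {P : Pr}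
      (ha : a ∉ Δ.dom) (d : ProcTy Ψ (Δ.snoc a ⟨_, A.unroll⟩) P c C) :
      ProcTy Ψ (Δ.snoc a ⟨_, .mu A⟩) (.sendUnfold a P) c C
  | unquote {Ψ : FCtx} {Δ : LCtx} {a : ℕ} {A : SType} {M : Tm} (ha : a ∉ Δ.dom)
      {n : ℕ} (e : Fin n ≃ Δ.dom)
      (d : HasTy Ψ M (.quoted n (fun i => (Δ.ty (e i)).1) (fun i => (Δ.ty (e i)).2) A.1 A.2)) :
      ProcTy Ψ Δ (.unquote a M (List.ofFn fun i => (e i).1)) a A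

end

/-! Weakening: every derivation in the context `Ψ` is, with the additional hypotheses `Φ`, a
derivation in the context `Φ, Ψ`. -/

mutual

/-- The derivation of `Φ, Ψ ⊢ M : τ` by the same rules. -/
def HasTy.weaken (Φ : FCtx) : {Ψ : FCtx} → {M : Tm} → {τ : FTy} →
    HasTy Ψ M τ → HasTy (Ψ ++ Φ) M τ
  | _, _, _, .quote d e => .quote (d.weaken Φ) e
  | _, _, _, .var l => .var (l.weaken Φ)
  | _, _, _, .fix d => .fix (d.weaken Φ)
  | _, _, _, .lam d => .lam (d.weaken Φ)
  | _, _, _, .app d d' => .app (d.weaken Φ) (d'.weaken Φ)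

/-- The derivation of `Φ, Ψ; Δ ⊢ P :: c : C` by the same rules. -/
def ProcTy.weaken (Φ : FCtx) : {Ψ : FCtx} → {Δ : LCtx} → {P : Pr} → {c : ℕ} → {C : SType} →
    ProcTy Ψ Δ P c C → ProcTy (Ψ ++ Φ) Δ P c C
  | _, _, _, _, _, .fwd h => .fwd h
  | _, _, _, _, _, .cut h ha hc d d' => .cut h ha hc (d.weaken Φ) (d'.weaken Φ)
  | _, _, _, _, _, .oneR => .oneR
  | _, _, _, _, _, .oneL ha h d => .oneL ha h (d.weaken Φ)
  | _, _, _, _, _, .downR d => .downR (d.weaken Φ)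
  | _, _, _, _, _, .downL ha d => .downL ha (d.weaken Φ)
  | _, _, _, _, _, .upR d => .upR (d.weaken Φ)
  | _, _, _, _, _, .upL ha d => .upL ha (d.weaken Φ)
  | _, _, _, _, _, .plusR k d => .plusR k (d.weaken Φ)
  | _, _, _, _, _, .plusL ha hac hc d => .plusL ha hac hc fun l => (d l).weaken Φ
  | _, _, _, _, _, .ampR ha d => .ampR ha fun l => (d l).weaken Φ
  | _, _, _, _, _, .ampL ha k d => .ampL ha k (d.weaken Φ)
  | _, _, _, _, _, .tensorR hb hba d => .tensorR hb hba (d.weaken Φ)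
  | _, _, _, _, _, .tensorL ha hb d => .tensorL ha hb (d.weaken Φ)
  | _, _, _, _, _, .lollyR hb d => .lollyR hb (d.weaken Φ)
  | _, _, _, _, _, .lollyL hb ha hbc d => .lollyL hb ha hbc (d.weaken Φ)
  | _, _, _, _, _, .andR d d' => .andR (d.weaken Φ) (d'.weaken Φ)
  | _, _, _, _, _, .andL ha d => .andL ha (d.weaken Φ)
  | _, _, _, _, _, .impR d => .impR (d.weaken Φ)
  | _, _, _, _, _, .impL ha d d' => .impL ha (d.weaken Φ) (d'.weaken Φ)
  | _, _, _, _, _, .muPosR d => .muPosR (d.weaken Φ)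
  | _, _, _, _, _, .muPosL ha d => .muPosL ha (d.weaken Φ)
  | _, _, _, _, _, .muNegR d => .muNegR (d.weaken Φ)
  | _, _, _, _, _, .muNegL ha d => .muNegL ha (d.weaken Φ)
  | _, _, _, _, _, .unquote ha e d => .unquote ha e (d.weaken Φ)

end

/-! ### Operators on continuous functions -/

section Operators

variable {X Y E : Type} [PartialOrder X] [PartialOrder Y] [PartialOrder E] [OrderBot X]
  [OrderBot Y] [OrderBot E]

open Classical in
/-- `f`, made strict in the component `π`. -/
def strictIn (π : CFun X E) (f : CFun X Y) : CFun X Y where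
  toFun x := if π x = ⊥ then ⊥ else f x
  cont s hs hd a ha := by
    have hπ : ∀ {x y}, x ≤ y → π y = ⊥ → π x = ⊥ := fun h e =>
      le_bot_iff.mp (e ▸ π.mono h)
    refine ⟨?_, fun b hb => ?_⟩
    · rintro _ ⟨x, hx, rfl⟩
      by_cases h : π x = ⊥
      · simp [h]
      · have h' : π a ≠ ⊥ := fun e => h (hπ (ha.1 hx) e)
        simpa [h, h'] using f.mono (ha.1 hx)
    · by_cases h : π a = ⊥
      · simp [h]
      · have h' : ∃ x ∈ s, π x ≠ ⊥ := by
          by_contra! h'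
          refine h (le_bot_iff.mp ((π.cont hs hd ha).2 ?_))
          rintro _ ⟨x, hx, rfl⟩
          exact (h' x hx).le
        obtain ⟨x₀, hx₀, h₀⟩ := h'
        simp only [h, if_false]
        refine (f.cont hs hd ha).2 ?_
        rintro _ ⟨x, hx, rfl⟩
        obtain ⟨z, hz, h1, h2⟩ := hd x₀ hx₀ x hx
        have hz' : π z ≠ ⊥ := fun e => h₀ (hπ h1 e)
        have := hb ⟨z, hz, rfl⟩
        simp only [hz', if_false] at this
        exact (f.mono h2).trans this

/-- `a ↦ strict (λ x. f (a, x))` -/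
def strictCurry [DirComplete Y] (f : CFun (E × X) Y) : CFun E (SFun X Y) where
  toFun a := ⟨CFun.curry (strictIn ⟨fun p => p.2, by fun_prop⟩ f) a, if_pos rfl⟩
  cont s hs hd a ha := by
    have h := (CFun.curry (strictIn ⟨fun p => p.2, by fun_prop⟩ f)).cont hs hd ha
    refine ⟨?_, fun g hg => h.2 ?_⟩
    · rintro _ ⟨x, hx, rfl⟩
      exact h.1 ⟨x, hx, rfl⟩
    · rintro _ ⟨x, hx, rfl⟩
      exact hg ⟨x, hx, rfl⟩

/-- The unit `X → X_⊥`. -/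
def up : CFun X (WithBot X) := ⟨fun x => x, scott_up⟩

/-- The counit `X_⊥ → X`. -/
def down [DirComplete X] : CFun (WithBot X) X :=
  ⟨liftExt fun x => x, scott_liftExt (f := fun x : X => x) (by fun_prop)⟩

theorem exists_fix [DirComplete X] :
    ∃ g : CFun (CFun X X) X, ∀ f : CFun X X, IsLUB (Set.range fun n : ℕ => f^[n] ⊥) (g f) := by
  have hc : ∀ n : ℕ, ScottContinuous fun f : CFun X X => f^[n] ⊥ := by
    intro n
    induction n with
    | zero => exact ScottContinuous.const ⊥
    | succ n ih =>
      simp only [Function.iterate_succ_apply']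
      exact CFun.scott_apply (by fun_prop) ih
  let k : ℕ → CFun (CFun X X) X := fun n => ⟨_, hc n⟩
  have hk : Monotone k := monotone_nat_of_le_succ fun n f =>
    f.mono.monotone_iterate_of_le_map bot_le n.le_succ
  obtain ⟨g, hg⟩ := CFun.exists_pointwise_lub (Set.range k) (Set.range_nonempty _)
    (directedOn_range.mpr hk.directed_le)
  refine ⟨g, fun f => ?_⟩
  have h := hg f
  rw [← Set.range_comp] at h
  exact h

/-- The least-fixed-point operator `fix f = ⨆ₙ fⁿ ⊥`. -/
def fix [DirComplete X] : CFun (CFun X X) X := exists_fix.choose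

/-- `f† (a) = fix (λ x. f (a, x))` -/
def dagger [DirComplete X] (f : CFun (E × X) X) : CFun E X := fix.comp (CFun.curry f)

/-- The trace `π_Y ∘ f ∘ ⟨id, (π_X ∘ f)†⟩`. -/
def trace [DirComplete X] (f : CFun (E × X) (Y × X)) : CFun E Y :=
  CFun.comp ⟨fun p => p.1, by fun_prop⟩ (f.comp
    ⟨fun a => (a, dagger (CFun.comp ⟨fun p => p.2, by fun_prop⟩ f) a), by fun_prop⟩)

end Operators

/-- `x ↦ (k : x, l ≠ k : ⊥)` -/
def injAt {I : Type} [DecidableEq I] {D : I → Dom} (k : I) : CFun (D k) (∀ i, D i) where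
  toFun x := Function.update ⊥ k x
  cont := scott_pi fun i => by
    by_cases h : i = k
    · subst h
      exact scott_congr (f := fun x => x) (by fun_prop) fun x => by simp
    · exact scott_congr (ScottContinuous.const ⊥) fun x => by simp [h]

/-- `x ↦ (k, x)` -/
def tag {I : Type} {D : I → Dom} (k : I) : CFun (D k) (Σ i, D i) :=
  ⟨fun x => ⟨k, x⟩, scott_sigma_mk (D := fun i => D i) k⟩

/-- `(x, ⊥) ↦ ⊥` and `(x, (k, ↑a)) ↦ f k (x, a)` -/
def caseSum {I : Type} {D : I → Dom} {X Y : Dom} (f : ∀ i, CFun (X × D i) Y) :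
    CFun (X × WithBot (Σ i, D i)) Y where
  toFun p := liftExt (fun s : Σ i, D i => f s.1 (p.1, s.2)) p.2
  cont := ScottContinuous.fromProd
    (fun x => scott_liftExt (f := fun s : Σ i, D i => f s.1 (x, s.2))
      (scott_sigma fun i => show ScottContinuous fun y => f i (x, y) by fun_prop))
    (fun s => by
      induction s using WithBot.recBotCoe with
      | bot => exact ScottContinuous.const ⊥
      | coe s => exact show ScottContinuous fun x : X => f s.1 (x, s.2) by fun_prop)

/-- `f × id` -/
def CFun.prodId {D D' E : Dom} (f : CFun D D') : CFun (Dom.prod D E) (Dom.prod D' E) :=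
  ⟨fun x => (f x.1, x.2), by fun_prop⟩

/-- `(x, y) ↦ (y, x)` -/
def CFun.swap {D E : Dom} : CFun (Dom.prod D E) (Dom.prod E D) :=
  ⟨fun x => (x.2, x.1), by fun_prop⟩

/-! ### Semantic clauses

`SemR U Δ⁺ Δ⁻ C⁻ C⁺` holds denotations of processes, as functions of the environment. In `SemL`,
the domains of one of the channels used are separated from those of the other channels. -/

abbrev SemR (U Dp Dn Cn Cp : Dom) : Type :=
  CFun U (Dom.fn (Dom.prod Dp Cn) (Dom.prod Dn Cp))

abbrev SemL (U Dp Ap Dn An Cn Cp : Dom) : Type :=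
  SemR U (Dom.prod Dp Ap) (Dom.prod Dn An) Cn Cp

/-- Pre- and postcomposition. -/
def SemR.conj {U Dp Dn Cn Cp Dp' Dn' : Dom} (f : CFun Dp' Dp) (g : CFun Dn Dn')
    (p : SemR U Dp Dn Cn Cp) : SemR U Dp' Dn' Cn Cp :=
  CFun.curry (β := Dp' × Cn) (γ := Dn' × Cp)
    ⟨fun x => (g (p x.1 (f x.2.1, x.2.2)).1, (p x.1 (f x.2.1, x.2.2)).2), by fun_prop⟩

namespace LCtx

variable {U Cn Cp : Dom} {Δ : LCtx} {a : ℕ} {A : SType}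

def openSnoc (h : a ∉ Δ.dom) (p : SemR U ((Δ.snoc a A).den .pos) ((Δ.snoc a A).den .neg) Cn Cp) :
    SemL U (Δ.den .pos) (A.dom .pos) (Δ.den .neg) (A.dom .neg) Cn Cp :=
  p.conj joinSnoc (splitSnoc h)

def closeSnoc (h : a ∉ Δ.dom)
    (p : SemL U (Δ.den .pos) (A.dom .pos) (Δ.den .neg) (A.dom .neg) Cn Cp) :
    SemR U ((Δ.snoc a A).den .pos) ((Δ.snoc a A).den .neg) Cn Cp :=
  p.conj (splitSnoc h) joinSnoc

end LCtx

namespace Clause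

variable {U Dp Dn Cn Cp Ap An A'p A'n Bp Bn T : Dom}

/-- The function `u ↦ (λ i. f (u, i))`. -/
abbrev mk {I O : Dom} (f : U × I → O) (hf : ScottContinuous f) : CFun U (Dom.fn I O) :=
  CFun.curry ⟨f, hf⟩

/-- The function `u ↦ strict_π (λ i. f (u, i))`. -/
abbrev mkStrict {I O E : Dom} (π : U × I → E) (hπ : ScottContinuous π) (f : U × I → O)
    (hf : ScottContinuous f) : CFun U (Dom.fn I O) :=
  CFun.curry (strictIn ⟨π, hπ⟩ ⟨f, hf⟩)

/-- `(a⁺, b⁻) ↦ (a⁻, b⁺) = (b⁻, a⁺)` -/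
def fwd {a : ℕ} {A : SType} :
    SemR U ((LCtx.single a A).den .pos) ((LCtx.single a A).den .neg) (A.dom .neg) (A.dom .pos) :=
  mk (I := Dom.prod ((LCtx.single a A).den .pos) (A.dom .neg))
    (O := Dom.prod ((LCtx.single a A).den .neg) (A.dom .pos))
    (fun x => (fun _ => x.2.2, x.2.1 ⟨a, Finset.mem_singleton_self a⟩))
    (ScottContinuous.prodMk (scott_pi fun _ => by fun_prop) (by fun_prop))

/-- The trace of `p u × q u` at the channel `a⁻ × a⁺`. -/
def cut {D'p D'n : Dom} (p : SemR U Dp Dn An Ap) (q : SemL U D'p Ap D'n An Cn Cp) :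
    SemR U (Dom.prod Dp D'p) (Dom.prod Dn D'n) Cn Cp :=
  CFun.curry (trace (E := U × ((Dp × D'p) × Cn)) (X := An × Ap) (Y := (Dn × D'n) × Cp)
    ⟨fun x =>
      let r := p x.1.1 (x.1.2.1.1, x.2.1)
      let s := q x.1.1 ((x.1.2.1.2, x.2.2), x.1.2.2)
      (((r.1, s.1.1), s.2), (s.1.2, r.2)), by fun_prop⟩)

/-- `1R`: `a⁻ ↦ ↑*` (in an empty context). -/
def oneR : SemR U Dp Dn Dom.unit (Dom.lift PUnit) :=
  mk (I := Dom.prod Dp Dom.unit) (O := Dom.prod Dn (Dom.lift PUnit))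
    (fun _ => (⊥, ((PUnit.unit : PUnit) : WithBot PUnit))) (ScottContinuous.const _)

/-- `1L`, strict in `a⁺`: `(δ⁺, a⁺, c⁻) ↦ (δ⁻, ⊥, c⁺)` where `p u (δ⁺, c⁻) = (δ⁻, c⁺)`. -/
def oneL (p : SemR U Dp Dn Cn Cp) : SemL U Dp (Dom.lift PUnit) Dn Dom.unit Cn Cp :=
  mkStrict (fun x => x.2.1.2) (by fun_prop)
    (fun x =>
      let r := p x.1 (x.2.1.1, x.2.2)
      ((r.1, ⊥), r.2)) (by fun_prop)

/-- `↓R`: `(δ⁺, a⁻) ↦ (δ⁻, ↑a⁺)` where `p u (δ⁺, a⁻) = (δ⁻, a⁺)`. -/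
def sendShiftR (p : SemR U Dp Dn An Ap) : SemR U Dp Dn An (Dom.lift Ap) :=
  mk (fun x =>
    let r := p x.1 x.2
    (r.1, (r.2 : WithBot Ap))) (by fun_prop)

/-- `↑L`: `(δ⁺, a⁺, c⁻) ↦ (δ⁻, ↑a⁻, c⁺)` where `p u (δ⁺, a⁺, c⁻) = (δ⁻, a⁻, c⁺)`. -/
def sendShiftL (p : SemL U Dp Ap Dn An Cn Cp) : SemL U Dp Ap Dn (Dom.lift An) Cn Cp :=
  mk (fun x =>
    let r := p x.1 x.2
    ((r.1.1, (r.1.2 : WithBot An)), r.2)) (by fun_prop)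

/-- `↑R`, strict in `a⁻`: `(δ⁺, ↑a⁻) ↦ p u (δ⁺, a⁻)`. -/
def recvShiftR (p : SemR U Dp Dn An Ap) : SemR U Dp Dn (Dom.lift An) Ap :=
  mkStrict (fun x => x.2.2) (by fun_prop) (fun x => p x.1 (x.2.1, down x.2.2)) (by fun_prop)

/-- `↓L`, strict in `a⁺`: `(δ⁺, ↑a⁺, c⁻) ↦ p u (δ⁺, a⁺, c⁻)`. -/
def recvShiftL (p : SemL U Dp Ap Dn An Cn Cp) : SemL U Dp (Dom.lift Ap) Dn An Cn Cp :=
  mkStrict (fun x => x.2.1.2) (by fun_prop)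
    (fun x => p x.1 ((x.2.1.1, down x.2.1.2), x.2.2)) (by fun_prop)

section Choice

variable {I : Type} {Fp Fn : I → Dom}

/-- `⊕Rₖ`: `(δ⁺, (aₗ⁻)ₗ) ↦ (δ⁻, (k, ↑aₖ⁺))` where `p u (δ⁺, aₖ⁻) = (δ⁻, aₖ⁺)`. -/
def tagR (k : I) (p : SemR U Dp Dn (Fn k) (Fp k)) : SemR U Dp Dn (Dom.pi Fn) (Dom.sum Fp) :=
  mk (fun x =>
    let r := p x.1 (x.2.1, x.2.2 k)
    (r.1, (tag k r.2 : WithBot (Σ i, Fp i)))) (by fun_prop)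

/-- `&Lₖ`: `(δ⁺, (aₗ⁺)ₗ, c⁻) ↦ (δ⁻, (k, ↑aₖ⁻), c⁺)` where `p u (δ⁺, aₖ⁺, c⁻) = (δ⁻, aₖ⁻, c⁺)`. -/
def tagL (k : I) (p : SemL U Dp (Fp k) Dn (Fn k) Cn Cp) :
    SemL U Dp (Dom.pi Fp) Dn (Dom.sum Fn) Cn Cp :=
  mk (fun x =>
    let r := p x.1 ((x.2.1.1, x.2.1.2 k), x.2.2)
    ((r.1.1, (tag k r.1.2 : WithBot (Σ i, Fn i))), r.2)) (by fun_prop)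

/-- `&R`, strict in `a⁻`: `(δ⁺, (k, ↑aₖ⁻)) ↦ (δ⁻, (k : aₖ⁺, l ≠ k : ⊥))` where
`p k u (δ⁺, aₖ⁻) = (δ⁻, aₖ⁺)`. -/
def caseR [DecidableEq I] (p : ∀ k, SemR U Dp Dn (Fn k) (Fp k)) :
    SemR U Dp Dn (Dom.sum Fn) (Dom.pi Fp) :=
  let f : CFun ((U × Dp) × WithBot (Σ i, Fn i)) (Dn × (∀ i, Fp i)) :=
    caseSum (X := Dom.prod U Dp) (Y := Dom.prod Dn (Dom.pi Fp)) fun k => ⟨fun y =>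
      let r := p k y.1.1 (y.1.2, y.2)
      (r.1, injAt (D := Fp) k r.2), by fun_prop⟩
  mkStrict (fun x => x.2.2) (by fun_prop) (fun x => f ((x.1, x.2.1), x.2.2)) (by fun_prop)

/-- `⊕L`, strict in `a⁺`: `(δ⁺, (k, ↑aₖ⁺), c⁻) ↦ (δ⁻, (k : aₖ⁻, l ≠ k : ⊥), c⁺)` where
`p k u (δ⁺, aₖ⁺, c⁻) = (δ⁻, aₖ⁻, c⁺)`. -/
def caseL [DecidableEq I] (p : ∀ k, SemL U Dp (Fp k) Dn (Fn k) Cn Cp) :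
    SemL U Dp (Dom.sum Fp) Dn (Dom.pi Fn) Cn Cp :=
  let f : CFun ((U × (Dp × Cn)) × WithBot (Σ i, Fp i)) ((Dn × (∀ i, Fn i)) × Cp) :=
    caseSum (X := Dom.prod U (Dom.prod Dp Cn)) (Y := Dom.prod (Dom.prod Dn (Dom.pi Fn)) Cp)
      fun k => ⟨fun y =>
        let r := p k y.1.1 ((y.1.2.1, y.2), y.1.2.2)
        ((r.1.1, injAt (D := Fn) k r.1.2), r.2), by fun_prop⟩
  mkStrict (fun x => x.2.1.2) (by fun_prop) (fun x => f ((x.1, (x.2.1.1, x.2.2)), x.2.1.2))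
    (by fun_prop)

end Choice

/-- `⊗R`: `((δ⁺, b⁺), (b⁻, a⁻)) ↦ ((δ⁻, b⁻), ↑(b⁺, a⁺))` where `p u (δ⁺, a⁻) = (δ⁻, a⁺)`. -/
def tensorR (p : SemR U Dp Dn An Ap) :
    SemL U Dp Bp Dn Bn (Dom.prod Bn An) (Dom.lift (Bp × Ap)) :=
  mk (fun x =>
    let r := p x.1 (x.2.1.1, x.2.2.2)
    ((r.1, x.2.2.1), ((x.2.1.2, r.2) : Bp × Ap))) (by fun_prop)

/-- `⊗L`, strict in the channel `a`: `(δ⁺, ↑(b⁺, a⁺), c⁻) ↦ (δ⁻, (b⁻, a⁻), c⁺)` where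
`p u (δ⁺, a⁺, b⁺, c⁻) = (δ⁻, a⁻, b⁻, c⁺)`. -/
def tensorL (p : SemL U (Dom.prod Dp Ap) Bp (Dom.prod Dn An) Bn Cn Cp) :
    SemL U Dp (Dom.lift (Bp × Ap)) Dn (Dom.prod Bn An) Cn Cp :=
  mkStrict (fun x => x.2.1.2) (by fun_prop)
    (fun x =>
      let v : Bp × Ap := down x.2.1.2
      let r := p x.1 (((x.2.1.1, v.2), v.1), x.2.2)
      ((r.1.1.1, (r.1.2, r.1.1.2)), r.2)) (by fun_prop)

/-- `⊸R`, strict in the channel `a`: `(δ⁺, ↑(b⁺, a⁻)) ↦ (δ⁻, (b⁻, a⁺))` where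
`p u (δ⁺, b⁺, a⁻) = (δ⁻, b⁻, a⁺)`. -/
def lollyR (p : SemL U Dp Bp Dn Bn An Ap) :
    SemR U Dp Dn (Dom.lift (Bp × An)) (Dom.prod Bn Ap) :=
  mkStrict (fun x => x.2.2) (by fun_prop)
    (fun x =>
      let v : Bp × An := down x.2.2
      let r := p x.1 ((x.2.1, v.1), v.2)
      (r.1.1, (r.1.2, r.2))) (by fun_prop)

/-- `⊸L`: `(δ⁺, b⁺, (b⁻, a⁺), c⁻) ↦ (δ⁻, b⁻, ↑(b⁺, a⁻), c⁺)` where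
`p u (δ⁺, a⁺, c⁻) = (δ⁻, a⁻, c⁺)`. -/
def lollyL (p : SemL U Dp Ap Dn An Cn Cp) :
    SemL U (Dom.prod Dp Bp) (Dom.prod Bn Ap) (Dom.prod Dn Bn) (Dom.lift (Bp × An)) Cn Cp :=
  mk (fun x =>
    let r := p x.1 ((x.2.1.1.1, x.2.1.2.2), x.2.2)
    (((r.1.1, x.2.1.2.1), ((x.2.1.1.2, r.1.2) : Bp × An)), r.2)) (by fun_prop)

/-- `∧R`: `(δ⁺, a⁻) ↦ (δ⁻, ↑(m u, a⁺))` where `p u (δ⁺, a⁻) = (δ⁻, a⁺)`, but `⊥` if `m u = ⊥`. -/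
def sendR (m : CFun U T) (p : SemR U Dp Dn An Ap) : SemR U Dp Dn An (Dom.lift (T × Ap)) :=
  mkStrict (fun x => m x.1) (by fun_prop)
    (fun x =>
      let r := p x.1 x.2
      (r.1, ((m x.1, r.2) : T × Ap))) (by fun_prop)

/-- `⊃L`: `(δ⁺, a⁺, c⁻) ↦ (δ⁻, ↑(m u, a⁻), c⁺)` where `p u (δ⁺, a⁺, c⁻) = (δ⁻, a⁻, c⁺)`, but `⊥`
if `m u = ⊥`. -/
def sendL (m : CFun U T) (p : SemL U Dp Ap Dn An Cn Cp) :
    SemL U Dp Ap Dn (Dom.lift (T × An)) Cn Cp :=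
  mkStrict (fun x => m x.1) (by fun_prop)
    (fun x =>
      let r := p x.1 x.2
      ((r.1.1, ((m x.1, r.1.2) : T × An)), r.2)) (by fun_prop)

/-- `⊃R`, strict in `a⁻`: `(δ⁺, ↑(v, a⁻)) ↦ p [u | x ↦ v] (δ⁺, a⁻)`. -/
def recvR (p : SemR (Dom.prod T U) Dp Dn An Ap) : SemR U Dp Dn (Dom.lift (T × An)) Ap :=
  mkStrict (fun x => x.2.2) (by fun_prop)
    (fun x =>
      let v : T × An := down x.2.2
      p (v.1, x.1) (x.2.1, v.2)) (by fun_prop)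

/-- `∧L`, strict in `a⁺`: `(δ⁺, ↑(v, a⁺), c⁻) ↦ p [u | x ↦ v] (δ⁺, a⁺, c⁻)`. -/
def recvL (p : SemL (Dom.prod T U) Dp Ap Dn An Cn Cp) :
    SemL U Dp (Dom.lift (T × Ap)) Dn An Cn Cp :=
  mkStrict (fun x => x.2.1.2) (by fun_prop)
    (fun x =>
      let v : T × Ap := down x.2.1.2
      p (v.1, x.1) ((x.2.1.1, v.2), x.2.2)) (by fun_prop)

/-- `ρR`: `p u`, composed with `Fold` at `a⁺` and with `Unfold` at `a⁻`. -/
def muR (fold : SFun Ap A'p) (unfold : SFun A'n An) (p : SemR U Dp Dn An Ap) :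
    SemR U Dp Dn A'n A'p :=
  mk (fun x =>
    let r := p x.1 (x.2.1, unfold x.2.2)
    (r.1, fold r.2)) (by fun_prop)

/-- `ρL`: `p u`, composed with `Fold` at `a⁻` and with `Unfold` at `a⁺`. -/
def muL (fold : SFun An A'n) (unfold : SFun A'p Ap) (p : SemL U Dp Ap Dn An Cn Cp) :
    SemL U Dp A'p Dn A'n Cn Cp :=
  mk (fun x =>
    let r := p x.1 ((x.2.1.1, unfold x.2.1.2), x.2.2)
    ((r.1.1, fold r.1.2), r.2)) (by fun_prop)

end Clause

/-! ### Denotations of terms and processes -/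

open Clause LCtx in
mutual

/-- `⟦Ψ ⊢ M : τ⟧ : ⟦Ψ⟧ → ⟦τ⟧` -/
def HasTy.den : {Ψ : FCtx} → {M : Tm} → {τ : FTy} → HasTy Ψ M τ → CFun (FCtx.den Ψ) τ.den
  | Ψ, _, _, .quote (Δ := Δ) (A := A) d e =>
    let p : SemR (FCtx.den Ψ) (Dom.pi fun i => (Δ.ty (e i)).dom .pos)
        (Dom.pi fun i => (Δ.ty (e i)).dom .neg) (A.dom .neg) (A.dom .pos) :=
      d.den.conj (ofFin e) (toFin e)
    up.comp p
  | _, _, _, .var l => l.den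
  | Ψ, _, _, .fix (τ := τ) d =>
    dagger (E := (FCtx.den Ψ)) (X := τ.den) (CFun.comp d.den CFun.swap)
  | Ψ, _, _, .lam (τ := τ) (σ := σ) d =>
    strictCurry (E := (FCtx.den Ψ)) (X := τ.den) (Y := σ.den)
      (CFun.comp d.den CFun.swap)
  | Ψ, _, _, .app (τ := τ) (σ := σ) d d' =>
    let f : CFun (FCtx.den Ψ) (SFun τ.den σ.den) := d.den
    ⟨fun u => f u (d'.den u), by fun_prop⟩

/-- `⟦Ψ; Δ ⊢ P :: c : C⟧ : ⟦Ψ⟧ → [⟦Δ⟧⁺ × ⟦C⟧⁻ → ⟦Δ⟧⁻ × ⟦C⟧⁺]` -/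
def ProcTy.den : {Ψ : FCtx} → {Δ : LCtx} → {P : Pr} → {c : ℕ} → {C : SType} →
    ProcTy Ψ Δ P c C → SemR (FCtx.den Ψ) (Δ.den .pos) (Δ.den .neg) (C.dom .neg) (C.dom .pos)
  | _, _, _, _, _, .fwd _ => fwd
  | _, _, _, _, _, .cut h ha _ d d' =>
    (cut d.den (openSnoc ha d'.den)).conj (split h) join
  | _, _, _, _, _, .oneR => oneR
  | _, _, _, _, _, .oneL ha _ d => closeSnoc ha (oneL d.den)
  | _, _, _, _, _, .downR d => sendShiftR d.den
  | _, _, _, _, _, .downL (A := A) ha d =>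
    closeSnoc ha (recvShiftL (openSnoc (A := ⟨_, A⟩) ha d.den))
  | _, _, _, _, _, .upR d => recvShiftR d.den
  | _, _, _, _, _, .upL ha d => closeSnoc ha (sendShiftL (openSnoc ha d.den))
  | _, _, _, _, _, .plusR (A := A) k d =>
    tagR (Fp := fun l => (A l).dom .pos) (Fn := fun l => (A l).dom .neg) k d.den
  | _, _, _, _, _, .plusL (A := A) ha _ _ d =>
    closeSnoc ha (caseL (Fp := fun l => (A l).dom .pos) (Fn := fun l => (A l).dom .neg)
      fun l => openSnoc ha (d l).den)
  | _, _, _, _, _, .ampR (A := A) _ d =>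
    caseR (Fp := fun l => (A l).dom .pos) (Fn := fun l => (A l).dom .neg) fun l => (d l).den
  | _, _, _, _, _, .ampL (A := A) ha k d =>
    closeSnoc ha (tagL (Fp := fun l => (A l).dom .pos) (Fn := fun l => (A l).dom .neg) k
      (openSnoc ha d.den))
  | _, _, _, _, _, .tensorR hb _ d => closeSnoc hb (tensorR d.den)
  | _, _, _, _, _, .tensorL (Δ := Δ) (A := A) ha hb d =>
    let f : CFun (Dom.prod (Δ.den .pos) (A.dom .pos)) ((Δ.snoc _ ⟨_, A⟩).den .pos) :=
      joinSnoc (A := ⟨_, A⟩)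
    let g : CFun ((Δ.snoc _ ⟨_, A⟩).den .neg) (Dom.prod (Δ.den .neg) (A.dom .neg)) :=
      splitSnoc ha
    closeSnoc ha (tensorL ((openSnoc hb d.den).conj f.prodId g.prodId))
  | _, _, _, _, _, .lollyR hb d => lollyR (openSnoc hb d.den)
  | _, _, _, _, _, .lollyL (Δ := Δ) (B := B) hb ha _ d =>
    let f : CFun ((Δ.snoc _ ⟨_, B⟩).den .pos) (Dom.prod (Δ.den .pos) (B.dom .pos)) :=
      splitSnoc hb
    let g : CFun (Dom.prod (Δ.den .neg) (B.dom .neg)) ((Δ.snoc _ ⟨_, B⟩).den .neg) :=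
      joinSnoc (A := ⟨_, B⟩)
    closeSnoc ha ((lollyL (openSnoc (notMem_of_snoc ha) d.den)).conj f.prodId g.prodId)
  | _, _, _, _, _, .andR d d' => sendR d.den d'.den
  | _, _, _, _, _, .andL ha d => closeSnoc ha (recvL (openSnoc ha d.den))
  | _, _, _, _, _, .impR d => recvR d.den
  | _, _, _, _, _, .impL ha d d' => closeSnoc ha (sendL d.den (openSnoc ha d'.den))
  | _, _, _, _, _, .muPosR (A := A) d => muR (A.fold .pos) (A.unfold .neg) d.den
  | _, _, _, _, _, .muPosL (A := A) ha d =>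
    closeSnoc ha (muL (A.fold .neg) (A.unfold .pos) (openSnoc ha d.den))
  | _, _, _, _, _, .muNegR (A := A) d => muR (A.fold .pos) (A.unfold .neg) d.den
  | _, _, _, _, _, .muNegL (A := A) ha d =>
    closeSnoc ha (muL (A.fold .neg) (A.unfold .pos) (openSnoc ha d.den))
  | Ψ, Δ, _, _, _, .unquote (A := A) _ e d =>
    let m : CFun (FCtx.den Ψ) (WithBot (CFun
        ((Dom.pi fun i => (Δ.ty (e i)).dom .pos) × A.dom .neg)
        ((Dom.pi fun i => (Δ.ty (e i)).dom .neg) × A.dom .pos))) := d.den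
    let p : SemR (FCtx.den Ψ) (Dom.pi fun i => (Δ.ty (e i)).dom .pos)
        (Dom.pi fun i => (Δ.ty (e i)).dom .neg) (A.dom .neg) (A.dom .pos) := down.comp m
    p.conj (toFin e) (ofFin e)

end

end

end SILL

-- Variables: looking up in a weakened context

namespace SILL

-- Weakening is naturality in the environment. Write `h : U' → U` for a continuous map of
-- environments. Every semantic clause turns maps `p` out of `U` into a map out of `U`, and every
-- one of them commutes with reindexing: the clause applied to `p ∘ h` is the clause applied to `p`,
-- followed by precomposition with `h`. Since weakening leaves the rules of a derivation as they
-- are, an induction on derivations with `h = FCtx.proj Φ Ψ` gives both statements together.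
--
-- The naturality needs no separate lemmas, because it holds by computation. Each clause is a
-- curried function of `(u, i)`, with `u` the environment and `i` the communications, and it
-- consults `u` only by passing it, possibly paired with a received value, to the denotations of the
-- premises. Both sides therefore unfold to the same function of `u` and `i`; the continuity and
-- strictness proofs attached to them are propositions and agree automatically. In particular, no
-- law of fixed points, of the trace or of recursive types enters: `fix` and `Rec.unfold` are chosen
-- by the axiom of choice, but they occur as the same constants on both sides and are never opened.
--
-- Binders are where the form of the context matters. The newest variable is the head of the list
-- and `Φ` is appended at the far end, so `((x, τ) :: Ψ) ++ Φ` is by definition `(x, τ) :: (Ψ ++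
-- Φ)`, and the projection for the extended context is by definition the identity on `⟦τ⟧` times
-- `FCtx.proj Φ Ψ`. The induction hypothesis below a binder hence has exactly the form that the
-- clause of the binder requires. What remains is the base case of variables, which is
-- `Lookup.den_weaken`.

theorem Lookup.den_weaken (Φ : FCtx) {x : ℕ} {τ : FTy} : ∀ {Ψ : FCtx} (l : Lookup x τ Ψ),
    (l.weaken Φ).den = l.den.comp (FCtx.proj Φ Ψ)
  -- The projection leaves the head component of the environment alone, and the lookup reads just
  -- this component.
  | _, .here => rfl
  | (_, σ) :: Ψ, .there _ l =>
    -- Precomposing the induction hypothesis with the projection to the tail gives the claim: the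
    -- projection for the longer context acts on the tail as `FCtx.proj Φ Ψ`, so dropping the head
    -- before or after it makes no difference. The domain is spelled out as a product in order that
    -- `u.2` makes sense.
    congrArg (fun k : CFun (FCtx.den (Ψ ++ Φ)) τ.den =>
      (k.comp ⟨fun u => u.2, by fun_prop⟩ : CFun (Dom.prod σ.den (FCtx.den (Ψ ++ Φ))) τ.den))
      (l.den_weaken Φ)

-- Terms and processes: naturality of every clause

-- The two inductions depend on each other: quoting makes a term out of a process, while sending a
-- value and running a quoted process have terms as premises. `Φ` stays fixed, but `Ψ` is quantified
-- inside, as `fix`, `lam` and the rules that receive a value move to a longer context.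
set_option maxHeartbeats 1600000 in
mutual

/-- Coherence of terms. -/
theorem HasTy.den_weaken (Φ : FCtx) : ∀ {Ψ : FCtx} {M : Tm} {τ : FTy} (d : HasTy Ψ M τ),
    (d.weaken Φ).den = d.den.comp (FCtx.proj Φ Ψ)
  | _, _, _, .quote d _ => by
    -- The pattern of nearly all cases: the equations of `weaken` and `den` expose the clause of the
    -- last rule, the induction hypothesis replaces the denotation of the weakened premise by a
    -- composite with the projection, and `rfl` moves the projection out of the clause. Here the
    -- clause only postcomposes with `up` and reindexes channels, neither of which touches the
    -- environment.
    simp only [HasTy.weaken, HasTy.den, d.den_weaken Φ]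
    rfl
  | _, _, _, .var l => l.den_weaken Φ
  -- Naturality of the parametrised fixed point: `dagger f` is `fix` after the currying of `f`, and
  -- currying commutes with reindexing of the parameter. The swap is there because the context holds
  -- the bound variable first, whereas `dagger` expects it last.
  | _, _, _, .fix d => by
    simp only [HasTy.weaken, HasTy.den, d.den_weaken Φ]
    rfl
  -- The test for `⊥` that makes the abstraction strict looks at the argument only, so it is the
  -- same test on both sides.
  | _, _, _, .lam d => by
    simp only [HasTy.weaken, HasTy.den, d.den_weaken Φ]
    rfl
  | _, _, _, .app d d' => by
    simp only [HasTy.weaken, HasTy.den, d.den_weaken Φ, d'.den_weaken Φ]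
    rfl

/-- Coherence of processes. -/
theorem ProcTy.den_weaken (Φ : FCtx) : ∀ {Ψ : FCtx} {Δ : LCtx} {P : Pr} {c : ℕ} {C : SType}
    (d : ProcTy Ψ Δ P c C), (d.weaken Φ).den = d.den.comp (FCtx.proj Φ Ψ)
  -- Forwarding and closing ignore the environment: their denotations are constant in it.
  | _, _, _, _, _, .fwd _ => rfl
  | _, _, _, _, _, .oneR => rfl
  -- The trace is natural in its parameter for the same reason as `dagger`, from which it is built.
  -- The environment is part of the parameter, outside the feedback loop, and both processes read
  -- the same one.
  | _, _, _, _, _, .cut _ _ _ d d' => by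
    simp only [ProcTy.weaken, ProcTy.den, d.den_weaken Φ, d'.den_weaken Φ]
    rfl
  -- As in the other left rules, `openSnoc` and `closeSnoc` are pre- and postcompositions on the
  -- communications, and they commute with a change of environment. Strictness is tested on the
  -- received communication.
  | _, _, _, _, _, .oneL _ _ d => by
    simp only [ProcTy.weaken, ProcTy.den, d.den_weaken Φ]
    rfl
  | _, _, _, _, _, .downR d => by
    simp only [ProcTy.weaken, ProcTy.den, d.den_weaken Φ]
    rfl
  | _, _, _, _, _, .downL _ d => by
    simp only [ProcTy.weaken, ProcTy.den, d.den_weaken Φ]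
    rfl
  | _, _, _, _, _, .upR d => by
    simp only [ProcTy.weaken, ProcTy.den, d.den_weaken Φ]
    rfl
  | _, _, _, _, _, .upL _ d => by
    simp only [ProcTy.weaken, ProcTy.den, d.den_weaken Φ]
    rfl
  | _, _, _, _, _, .plusR _ d => by
    simp only [ProcTy.weaken, ProcTy.den, d.den_weaken Φ]
    rfl
  | _, _, _, _, _, .plusL _ _ _ d => by
    -- There is one premise for each label, so the induction hypothesis is collected into a family,
    -- which can then be rewritten under the binder for the label. The branch is selected by the
    -- received communication and not by the environment.
    have ih := fun l => (d l).den_weaken Φ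
    simp only [ProcTy.weaken, ProcTy.den, ih]
    rfl
  | _, _, _, _, _, .ampR _ d => by
    have ih := fun l => (d l).den_weaken Φ
    simp only [ProcTy.weaken, ProcTy.den, ih]
    rfl
  | _, _, _, _, _, .ampL _ _ d => by
    simp only [ProcTy.weaken, ProcTy.den, d.den_weaken Φ]
    rfl
  | _, _, _, _, _, .tensorR _ _ d => by
    simp only [ProcTy.weaken, ProcTy.den, d.den_weaken Φ]
    rfl
  | _, _, _, _, _, .tensorL _ _ d => by
    simp only [ProcTy.weaken, ProcTy.den, d.den_weaken Φ]
    rfl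
  | _, _, _, _, _, .lollyR _ d => by
    simp only [ProcTy.weaken, ProcTy.den, d.den_weaken Φ]
    rfl
  | _, _, _, _, _, .lollyL _ _ _ d => by
    simp only [ProcTy.weaken, ProcTy.den, d.den_weaken Φ]
    rfl
  -- Here the test for `⊥` does depend on the environment, through the value that is sent. By the
  -- induction hypothesis for the term, the value at `u` in the larger context is the value at the
  -- projection of `u`, so the two tests are the same proposition.
  | _, _, _, _, _, .andR d d' => by
    simp only [ProcTy.weaken, ProcTy.den, d.den_weaken Φ, d'.den_weaken Φ]
    rfl
  -- The premise lives in the extended context and is evaluated at the received value paired with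
  -- `u`. The projection keeps the former and projects the latter, as the clause `recvL` demands.
  | _, _, _, _, _, .andL _ d => by
    simp only [ProcTy.weaken, ProcTy.den, d.den_weaken Φ]
    rfl
  | _, _, _, _, _, .impR d => by
    simp only [ProcTy.weaken, ProcTy.den, d.den_weaken Φ]
    rfl
  | _, _, _, _, _, .impL _ d d' => by
    simp only [ProcTy.weaken, ProcTy.den, d.den_weaken Φ, d'.den_weaken Φ]
    rfl
  -- `Fold` and `Unfold` are fixed maps that depend on the type alone; that they are mutually
  -- inverse is not needed.
  | _, _, _, _, _, .muPosR d => by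
    simp only [ProcTy.weaken, ProcTy.den, d.den_weaken Φ]
    rfl
  | _, _, _, _, _, .muPosL _ d => by
    simp only [ProcTy.weaken, ProcTy.den, d.den_weaken Φ]
    rfl
  | _, _, _, _, _, .muNegR d => by
    simp only [ProcTy.weaken, ProcTy.den, d.den_weaken Φ]
    rfl
  | _, _, _, _, _, .muNegL _ d => by
    simp only [ProcTy.weaken, ProcTy.den, d.den_weaken Φ]
    rfl
  -- Running a quoted process postcomposes the term with `down` and then reindexes the channels, so
  -- the projection on the right stays where it is by associativity of composition.
  | _, _, _, _, _, .unquote _ _ d => by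
    simp only [ProcTy.weaken, ProcTy.den, d.den_weaken Φ]
    rfl

end

end SILL

theorem mainTheorem11 (Φ Ψ : SILL.FCtx) :
    (∀ (M : SILL.Tm) (τ : SILL.FTy) (d : SILL.HasTy Ψ M τ),
      (d.weaken Φ).den = d.den.comp (SILL.FCtx.proj Φ Ψ)) ∧
    (∀ (Δ : SILL.LCtx) (P : SILL.Pr) (a : ℕ) (A : SILL.SType) (d : SILL.ProcTy Ψ Δ P a A),
      (d.weaken Φ).den = d.den.comp (SILL.FCtx.proj Φ Ψ)) :=
  ⟨fun _ _ d => d.den_weaken Φ, fun _ _ _ _ d => d.den_weaken Φ⟩
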